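/- Let $E_1, E_2, \ldots$ be a sequence of finite sets. Let $X^*=\bigsqcup_{n\ge 0} X^n$, where $X^n=E_1\times\cdots\times E_n$ (and $X^0$ consists of the empty word), be the rooted tree whose root is the empty word and in which $v\in X^n$ is connected by an edge to each $ve\in X^{n+1}$, $e\in E_{n+1}$. Let $\operatorname{Aut} X^*$ be the group of automorphisms of this rooted tree. It acts by homeomorphisms on the boundary $X^\omega=\prod_{i\ge1}E_i$, which carries the product topology of the discrete spaces $E_i$. For $g\in\operatorname{Aut}X^*$ and $v\in X^n$, the section $g|_v$ is the automorphism of the rooted tree $X^*_{(n)}$ of finite words of the sequence $E_{n+1},E_{n+2},\ldots$ determined by $g(vw)=g(v)\,g|_v(w)$ for all $w\in X^*_{(n)}$. The automorphism $g$ is called bounded if the number of $v\in X^n$ such that $g|_v$ is non-trivial is bounded by a constant not depending on $n$. Let $G\le\operatorname{Aut}X^*$ be a group consisting of bounded automorphisms. For $w\in X^\omega$, let $\mathfrak{G}_w$ be the group of germs at $w$ (the isotropy group at $w$ of the groupoid of germs of the action of $G$ on $X^\omega$), i.e. the quotient of the stabilizer $G_w$ by the normal subgroup of those elements of $G_w$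 that act trivially on some neighborhood of $w$. A group is called amenable if it has a finitely additive probability measure, defined on all its subsets, that is invariant under left multiplication. Then: 1. If $\mathfrak{G}_w$ is amenable for every $w\in X^\omega$, then $G$ is amenable. 2. If for every $w\in X^\omega$ the group $\mathfrak{G}_w$ has no free non-abelian subgroups, then $G$ has no free non-abelian subgroups. -/

import Mathlib

/-! ## Amenability and free subgroups -/

/-- An invariant mean on a `G`-set `X`: a finitely additive, `G`-invariant probability measure
defined on all subsets of `X`. -/
structure IsInvariantMean (G : Type*) {X : Type*} [Group G] [MulAction G X]
    (μ : Set X → ℝ) : Prop where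
  mem_unitInterval : ∀ A : Set X, μ A ∈ Set.Icc (0 : ℝ) 1
  total : μ Set.univ = 1
  additive : ∀ A B : Set X, Disjoint A B → μ (A ∪ B) = μ A + μ B
  invariant : ∀ (g : G) (A : Set X), μ ((fun x => g • x) '' A) = μ A

/-- An action is amenable if it admits an invariant mean. -/
def IsAmenableAction (G X : Type*) [Group G] [MulAction G X] : Prop :=
  ∃ μ : Set X → ℝ, IsInvariantMean G μ

/-- A (discrete) group is amenable if its action on itself by left multiplication is amenable. -/
def IsAmenableGroup (G : Type*) [Group G] : Prop :=
  IsAmenableAction G G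

/-- `G` contains a free non-abelian subgroup. -/
def HasNonabelianFreeSubgroup (G : Type*) [Group G] : Prop :=
  ∃ F : Subgroup G, IsFreeGroup F ∧ ∃ a b : F, a * b ≠ b * a

/-! ## Groups of germs -/

section Germs

variable (G : Type*) {X : Type*} [Group G] [MulAction G X] [TopologicalSpace X]

/-- The elements of the stabilizer of `x` acting trivially on a neighbourhood of `x`. -/
def germKernel (x : X) : Subgroup (MulAction.stabilizer G x) where
  carrier := {g | ∀ᶠ y in nhds x, g • y = y}
  one_mem' := Filter.Eventually.of_forall fun y => one_smul _ y
  mul_mem' := by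
    intro a b ha hb
    filter_upwards [ha, hb] with y hya hyb
    rw [mul_smul, hyb, hya]
  inv_mem' := by
    intro a ha
    filter_upwards [ha] with y hy
    exact inv_smul_eq_iff.2 hy.symm

instance germKernel_normal [ContinuousConstSMul G X] (x : X) : (germKernel G x).Normal where
  conj_mem := by
    intro a ha k
    have hk : Filter.Tendsto (fun y : X => ((k⁻¹ : MulAction.stabilizer G x) : G) • y)
        (nhds x) (nhds x) := by
      have h := (continuous_const_smul ((k⁻¹ : MulAction.stabilizer G x) : G)).tendsto x
      have hx : ((k⁻¹ : MulAction.stabilizer G x) : G) • x = x := (k⁻¹).2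
      rwa [hx] at h
    have h := hk.eventually ha
    filter_upwards [h] with y hy
    have hy' : a • (k⁻¹ • y) = k⁻¹ • y := hy
    rw [mul_smul, mul_smul, hy', smul_inv_smul]

/-- The isotropy group (group of germs) at `x` of the groupoid of germs of the action of `G`:
two elements of the stabilizer of `x` define the same germ at `x` exactly when they differ by an
element acting trivially on a neighbourhood of `x`. -/
abbrev IsotropyGroup [ContinuousConstSMul G X] (x : X) : Type _ :=
  MulAction.stabilizer G x ⧸ germKernel G x

end Germs

/-! ## Spherically homogeneous rooted trees -/

namespace RootedTree

universe u

/-- Words `(e₀, …, e_{n-1})` with `eᵢ ∈ E i`: the vertices of the `n`-th level of the tree. -/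
abbrev Word (E : ℕ → Type u) (n : ℕ) : Type u := ∀ i : Fin n, E i

/-- The sequence `(E n, E (n+1), …)`, which defines the truncated tree. -/
abbrev shift (E : ℕ → Type u) (n : ℕ) : ℕ → Type u := fun i => E (n + i)

/-- The vertices of the tree: the words of all finite lengths. -/
abbrev Vertex (E : ℕ → Type u) : Type u := Σ n : ℕ, Word E n

variable {E : ℕ → Type u}

namespace Word

/-- The continuation `v e` of the word `v` by one letter. -/
def snoc {n : ℕ} (v : Word E n) (e : E n) : Word E (n + 1) :=
  Fin.snoc (α := fun i : Fin (n + 1) => E i) v e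

/-- The beginning of length `m` of a word. -/
def take {m n : ℕ} (h : m ≤ n) (v : Word E n) : Word E m := fun i => v (Fin.castLE h i)

/-- The concatenation `v w`; the letters of `w` are taken from `E n, E (n+1), …`. -/
def append {n m : ℕ} (v : Word E n) (w : Word (shift E n) m) : Word E (n + m) :=
  Fin.addCases (motive := fun i : Fin (n + m) => E i) v w

/-- The word left after deleting the first `n` letters. -/
def drop (n : ℕ) {m : ℕ} (v : Word E (n + m)) : Word (shift E n) m :=
  fun i => v (Fin.natAdd n i)

theorem take_snoc {n : ℕ} (v : Word E n) (e : E n) : (v.snoc e).take (Nat.le_succ n) = v := by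
  funext i
  exact Fin.snoc_castSucc (α := fun i : Fin (n + 1) => E i) e v i

theorem snoc_take {n : ℕ} (v : Word E (n + 1)) :
    (v.take (Nat.le_succ n)).snoc (v (Fin.last n)) = v :=
  Fin.snoc_init_self (α := fun i : Fin (n + 1) => E i) v

theorem take_append {n m : ℕ} (v : Word E n) (w : Word (shift E n) m) :
    (v.append w).take (Nat.le_add_right n m) = v := by
  funext i
  exact Fin.addCases_left (motive := fun i : Fin (n + m) => E i) i

theorem drop_append {n m : ℕ} (v : Word E n) (w : Word (shift E n) m) :
    (v.append w).drop n = w := by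
  funext i
  exact Fin.addCases_right (motive := fun i : Fin (n + m) => E i) i

theorem append_take_drop {n m : ℕ} (u : Word E (n + m)) :
    (u.take (Nat.le_add_right n m)).append (u.drop n) = u := by
  funext i
  refine Fin.addCases (fun j => ?_) (fun j => ?_) i
  · exact Fin.addCases_left (motive := fun i : Fin (n + m) => E i) j
  · exact Fin.addCases_right (motive := fun i : Fin (n + m) => E i) j

theorem ext_take_drop {n m : ℕ} {u u' : Word E (n + m)}
    (h : u.take (Nat.le_add_right n m) = u'.take (Nat.le_add_right n m))
    (h' : u.drop n = u'.drop n) : u = u' := by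
  rw [← append_take_drop u, ← append_take_drop u', h, h']

theorem take_append_succ {n m : ℕ} (v : Word E n) (w : Word (shift E n) (m + 1)) :
    (v.append w).take (Nat.le_succ (n + m)) = v.append (w.take (Nat.le_succ m)) := by
  apply ext_take_drop
  · exact (take_append v w).trans (take_append v _).symm
  · rw [drop_append]
    funext i
    exact congrFun (drop_append v w) (Fin.castSucc i)

end Word

/-- `y` is a continuation of `x` by one letter. -/
def IsChild (x y : Vertex E) : Prop := ∃ e : E x.1, y = ⟨x.1 + 1, x.2.snoc e⟩

theorem IsChild.level {x y : Vertex E} (h : IsChild x y) : y.1 = x.1 + 1 := by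
  obtain ⟨e, rfl⟩ := h
  rfl

theorem isChild_mk {n : ℕ} {v : Word E n} {v' : Word E (n + 1)} :
    IsChild ⟨n, v⟩ ⟨n + 1, v'⟩ ↔ v'.take (Nat.le_succ n) = v := by
  constructor
  · rintro ⟨e, h⟩
    obtain rfl := eq_of_heq (Sigma.mk.inj h).2
    exact Word.take_snoc v e
  · rintro rfl
    exact ⟨v' (Fin.last n), by rw [Word.snoc_take]⟩

/-- The rooted tree of finite words, as a graph: two vertices are adjacent if one of them is a
continuation of the other by one letter. -/
def tree (E : ℕ → Type u) : SimpleGraph (Vertex E) where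
  Adj x y := IsChild x y ∨ IsChild y x
  symm := ⟨fun _ _ h => h.symm⟩
  loopless := ⟨fun x h => by
    rcases h with h | h <;> exact absurd h.level (by omega)⟩

/-- The root: the empty word. -/
def root (E : ℕ → Type u) : Vertex E := ⟨0, fun i => i.elim0⟩

/-- The automorphism group of the rooted tree: the graph automorphisms fixing the root. -/
def autSubgroup (E : ℕ → Type u) : Subgroup (tree E ≃g tree E) where
  carrier := {g | g (root E) = root E}
  one_mem' := rfl
  mul_mem' := by
    intro a b ha hb
    have ha' : a (root E) = root E := ha
    have hb' : b (root E) = root E := hb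
    change a (b (root E)) = root E
    rw [hb', ha']
  inv_mem' := by
    intro a ha
    have ha' : a (root E) = root E := ha
    exact (RelIso.symm_apply_eq a).2 ha'.symm

/-- The automorphism group of the rooted tree. -/
abbrev TreeAut (E : ℕ → Type u) : Type u := autSubgroup E

theorem level_apply (g : TreeAut E) (x : Vertex E) : (g.1 x).1 = x.1 := by
  obtain ⟨n, v⟩ := x
  induction n using Nat.strong_induction_on generalizing g with
  | _ n ih =>
    rcases n with _ | n
    · have h : (⟨0, v⟩ : Vertex E) = root E := by
        unfold root
        congr 1
        funext i
        exact i.elim0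
      rw [h, show g.1 (root E) = root E from g.2]
    · have hadj : (tree E).Adj ⟨n, v.take (Nat.le_succ n)⟩ ⟨n + 1, v⟩ :=
        Or.inl (isChild_mk.2 rfl)
      have hp := ih n (Nat.lt_succ_self n) g (v.take (Nat.le_succ n))
      rcases (g.1.map_rel_iff).2 hadj with h | h
      · exact h.level.trans (by rw [hp])
      · have hl := h.level
        rw [hp] at hl
        dsimp only at hl
        have hinv := ih (g.1 ⟨n + 1, v⟩).1 (by omega) g⁻¹ (g.1 ⟨n + 1, v⟩).2
        have he : (g⁻¹ : TreeAut E).1 (g.1 ⟨n + 1, v⟩) = ⟨n + 1, v⟩ :=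
          g.1.symm_apply_apply _
        have hinv' : ((g⁻¹ : TreeAut E).1 (g.1 ⟨n + 1, v⟩)).1 = (g.1 ⟨n + 1, v⟩).1 := hinv
        rw [he] at hinv'
        dsimp only at hinv'
        omega

namespace TreeAut

/-- The action of an automorphism on the words of length `n`. -/
def onLevel (g : TreeAut E) (n : ℕ) (v : Word E n) : Word E n :=
  fun i => (g.1 ⟨n, v⟩).2 ⟨i, i.2.trans_eq (level_apply g ⟨n, v⟩).symm⟩

theorem apply_mk (g : TreeAut E) (n : ℕ) (v : Word E n) :
    g.1 ⟨n, v⟩ = ⟨n, g.onLevel n v⟩ := by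
  have key : ∀ (x : Vertex E) (h : x.1 = n),
      x = ⟨n, fun i => x.2 ⟨i, i.2.trans_eq h.symm⟩⟩ := by
    rintro x rfl
    rfl
  exact key _ (level_apply g ⟨n, v⟩)

theorem onLevel_eq_iff (g : TreeAut E) {n : ℕ} {v w : Word E n} :
    g.onLevel n v = w ↔ g.1 ⟨n, v⟩ = ⟨n, w⟩ := by
  rw [apply_mk]
  constructor
  · rintro rfl
    rfl
  · intro h
    exact eq_of_heq (Sigma.mk.inj h).2

theorem onLevel_one (n : ℕ) (v : Word E n) : (1 : TreeAut E).onLevel n v = v :=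
  (onLevel_eq_iff _).2 rfl

theorem onLevel_mul (g h : TreeAut E) (n : ℕ) (v : Word E n) :
    (g * h).onLevel n v = g.onLevel n (h.onLevel n v) := by
  rw [onLevel_eq_iff]
  change g.1 (h.1 ⟨n, v⟩) = _
  rw [apply_mk, apply_mk]

theorem onLevel_take_succ (g : TreeAut E) {n : ℕ} (v : Word E (n + 1)) :
    (g.onLevel (n + 1) v).take (Nat.le_succ n) = g.onLevel n (v.take (Nat.le_succ n)) := by
  have hadj : (tree E).Adj ⟨n, v.take (Nat.le_succ n)⟩ ⟨n + 1, v⟩ :=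
    Or.inl (isChild_mk.2 rfl)
  have h := (g.1.map_rel_iff).2 hadj
  rw [apply_mk, apply_mk] at h
  rcases h with h | h
  · exact isChild_mk.1 h
  · exact absurd h.level (by dsimp only; omega)

theorem onLevel_take (g : TreeAut E) {m n : ℕ} (h : m ≤ n) (v : Word E n) :
    (g.onLevel n v).take h = g.onLevel m (v.take h) := by
  induction n, h using Nat.le_induction with
  | base => rfl
  | succ n hmn ih =>
    have h1 := ih (v.take (Nat.le_succ n))
    rw [← onLevel_take_succ] at h1
    exact h1

/-- The automorphism of the rooted tree given by a family of permutations of the levels that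
agrees with taking beginnings of words. -/
def ofLevels (σ : ∀ n : ℕ, Word E n ≃ Word E n)
    (hσ : ∀ (n : ℕ) (v : Word E (n + 1)),
      (σ (n + 1) v).take (Nat.le_succ n) = σ n (v.take (Nat.le_succ n))) : TreeAut E :=
  ⟨{ toEquiv := Equiv.sigmaCongrRight σ
     map_rel_iff' := by
      have key : ∀ x y : Vertex E, IsChild (Equiv.sigmaCongrRight σ x)
          (Equiv.sigmaCongrRight σ y) ↔ IsChild x y := by
        rintro ⟨n, v⟩ ⟨k, w⟩
        change IsChild ⟨n, σ n v⟩ ⟨k, σ k w⟩ ↔ _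
        by_cases hk : k = n + 1
        · subst hk
          rw [isChild_mk, isChild_mk, hσ, EmbeddingLike.apply_eq_iff_eq]
        · exact ⟨fun h => absurd h.level hk, fun h => absurd h.level hk⟩
      intro x y
      exact or_congr (key x y) (key y x) },
    by
      change (⟨0, σ 0 _⟩ : Vertex E) = ⟨0, _⟩
      congr 1
      funext i
      exact i.elim0⟩

theorem ofLevels_onLevel (σ : ∀ n : ℕ, Word E n ≃ Word E n)
    (hσ : ∀ (n : ℕ) (v : Word E (n + 1)),
      (σ (n + 1) v).take (Nat.le_succ n) = σ n (v.take (Nat.le_succ n)))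
    (n : ℕ) (v : Word E n) : (ofLevels σ hσ).onLevel n v = σ n v :=
  (onLevel_eq_iff _).2 rfl

/-- The action of the section of `g` at `v` on the words of length `m`. -/
def sectionFun (g : TreeAut E) {n : ℕ} (v : Word E n) (m : ℕ)
    (w : Word (shift E n) m) : Word (shift E n) m :=
  (g.onLevel (n + m) (v.append w)).drop n

theorem append_sectionFun (g : TreeAut E) {n : ℕ} (v : Word E n) (m : ℕ)
    (w : Word (shift E n) m) :
    g.onLevel (n + m) (v.append w) = (g.onLevel n v).append (g.sectionFun v m w) := by
  have h := onLevel_take g (Nat.le_add_right n m) (v.append w)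
  rw [Word.take_append] at h
  rw [← h]
  exact (Word.append_take_drop _).symm

theorem sectionFun_inverse (g h : TreeAut E) (hgh : h * g = 1) {n : ℕ} (v : Word E n) (m : ℕ)
    (w : Word (shift E n) m) :
    h.sectionFun (g.onLevel n v) m (g.sectionFun v m w) = w := by
  rw [sectionFun, ← append_sectionFun, ← onLevel_mul, hgh, onLevel_one, Word.drop_append]

/-- The section `g|_v` of `g` at a vertex `v` of level `n`, an automorphism of the truncated tree;
it is characterized by `g (v w) = g(v) g|_v(w)`, see `onLevel_append`. -/
def sectionAt (g : TreeAut E) {n : ℕ} (v : Word E n) : TreeAut (shift E n) :=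
  ofLevels
    (fun m =>
      { toFun := g.sectionFun v m
        invFun := g⁻¹.sectionFun (g.onLevel n v) m
        left_inv := fun w => sectionFun_inverse g g⁻¹ (inv_mul_cancel g) v m w
        right_inv := fun w => by
          have h := sectionFun_inverse g⁻¹ g (mul_inv_cancel g) (g.onLevel n v) m w
          rwa [← onLevel_mul, inv_mul_cancel, onLevel_one] at h })
    (by
      intro m w
      change (g.sectionFun v (m + 1) w).take _ = g.sectionFun v m (w.take _)
      have h := onLevel_take_succ g (n := n + m) (v.append w)
      rw [Word.take_append_succ] at h
      unfold sectionFun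
      rw [← h]
      rfl)

theorem onLevel_append (g : TreeAut E) {n m : ℕ} (v : Word E n) (w : Word (shift E n) m) :
    g.onLevel (n + m) (v.append w) =
      (g.onLevel n v).append ((g.sectionAt v).onLevel m w) := by
  rw [append_sectionFun]
  unfold sectionAt
  rw [ofLevels_onLevel]
  rfl

/-- The number of vertices `v` of level `n` such that the section `g|_v` is non-trivial. -/
noncomputable def activity (g : TreeAut E) (n : ℕ) : ℕ∞ :=
  Set.encard {v : Word E n | g.sectionAt v ≠ 1}

/-- An automorphism is bounded if the sequence of the numbers of non-trivial sections on the
levels is bounded. -/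
def IsBounded (g : TreeAut E) : Prop := ∃ C : ℕ, ∀ n : ℕ, g.activity n ≤ C

end TreeAut

/-- The boundary of the tree: the space of infinite words `(e₀, e₁, …)` with `eᵢ ∈ E i`. -/
def Boundary (E : ℕ → Type u) : Type u := ∀ i : ℕ, E i

/-- The product topology, where every `E i` is discrete. -/
instance Boundary.instTopologicalSpace : TopologicalSpace (Boundary E) :=
  @Pi.topologicalSpace ℕ E (fun _ => ⊥)

/-- The beginning of length `n` of an infinite word. -/
def Boundary.beginning (ξ : Boundary E) (n : ℕ) : Word E n := fun i => ξ i

theorem Boundary.beginning_injective {ξ η : Boundary E}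
    (h : ∀ n, ξ.beginning n = η.beginning n) : ξ = η := by
  funext n
  exact congrFun (h (n + 1)) (Fin.last n)

/-- The action of automorphisms of the tree on infinite words; it is characterized by
`beginning_smul`. -/
instance Boundary.instSMul : SMul (TreeAut E) (Boundary E) where
  smul g ξ := fun n => g.onLevel (n + 1) (ξ.beginning (n + 1)) (Fin.last n)

theorem Boundary.beginning_smul (g : TreeAut E) (ξ : Boundary E) (n : ℕ) :
    (g • ξ).beginning n = g.onLevel n (ξ.beginning n) := by
  funext i
  exact congrFun (TreeAut.onLevel_take g (Nat.succ_le_of_lt i.2) (ξ.beginning n)).symm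
    (Fin.last (i : ℕ))

instance Boundary.instMulAction : MulAction (TreeAut E) (Boundary E) where
  one_smul ξ := Boundary.beginning_injective fun n => by
    rw [Boundary.beginning_smul, TreeAut.onLevel_one]
  mul_smul g h ξ := Boundary.beginning_injective fun n => by
    simp only [Boundary.beginning_smul, TreeAut.onLevel_mul]

instance Boundary.instContinuousConstSMul : ContinuousConstSMul (TreeAut E) (Boundary E) where
  continuous_const_smul g := by
    let _ : ∀ i, TopologicalSpace (E i) := fun _ => ⊥
    have _ : ∀ i, DiscreteTopology (E i) := fun _ => ⟨rfl⟩
    refine continuous_pi fun n => ?_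
    have h1 : Continuous fun ξ : Boundary E => ξ.beginning (n + 1) :=
      continuous_pi fun i => continuous_apply (A := E) (i : ℕ)
    have h2 : Continuous fun v : Word E (n + 1) => g.onLevel (n + 1) v (Fin.last n) :=
      continuous_of_discreteTopology
    exact h2.comp h1

instance Boundary.instContinuousConstSMulSubgroup (G : Subgroup (TreeAut E)) :
    ContinuousConstSMul G (Boundary E) where
  continuous_const_smul g := continuous_const_smul (g : TreeAut E)

end RootedTree

open Filter Topology

/-! A bounded automorphism has only finitely many singular points on the boundary; near every other
point it changes only finitely many letters. The group is therefore built from finitary germs, which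
generate locally finite behaviour, and from the isotropy groups, and the task is to glue these
together by an amenable action.

The gluing tool is extensive amenability of the action on the boundary: a `G`-invariant mean on the
finite subsets of the boundary for which almost every set contains any prescribed finite set. It
holds because finite parts of the orbital graphs have exhaustions with boundedly many boundary edges
(`Boundary.hasSmallCapacity`), so that the capacity of finite sets is zero. Random subsets with
slowly varying inclusion probabilities are then almost invariant, and an ultralimit makes them
invariant (`HasSmallCapacity.exists_invariant_mean`).

For amenability, let `G` act on configurations: a class of germs of `G` modulo finitary germs at
each point, trivial at all but finitely many points. The stabilizer of a configuration is an
increasing union of finite groups (`isAmenableGroup_stabilizer_configuration`). An invariant mean on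
configurations comes from choosing a random finite set `A` and then, at each point of `A`, a random
class by means supplied by the amenable isotropy groups. An element `g` alters the trivial
configuration only at singular points, which almost every `A` absorbs
(`isAmenableAction_configurations`). An amenable action with amenable stabilizers gives an amenable
group.

For free subgroups, let `F` be a free non-abelian subgroup. Some point has the property that only
the identity of `F` has trivial germ there (`exists_forall_germ_ne`); otherwise compactness would
produce finitely many non-trivial normal subgroups of a free non-abelian group with trivial
intersection. The stabilizer of that point in `F` embeds in the isotropy group, so it is free and
abelian, hence cyclic. Extensive amenability gives an `F`-invariant mean on the orbit, so `F` would
be amenable, contradicting the paradoxical decomposition. -/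

/-! ## Means as positive normalized functionals -/

/-- A real function is bounded. -/
def BoundedFun {X : Type*} (f : X → ℝ) : Prop := ∃ C : ℝ, ∀ x, |f x| ≤ C

namespace BoundedFun

variable {X Y : Type*} {f g : X → ℝ}

theorem comp (hf : BoundedFun f) (φ : Y → X) : BoundedFun fun y => f (φ y) :=
  let ⟨C, hC⟩ := hf
  ⟨C, fun y => hC (φ y)⟩

theorem add (hf : BoundedFun f) (hg : BoundedFun g) : BoundedFun fun x => f x + g x :=
  let ⟨C, hC⟩ := hf
  let ⟨D, hD⟩ := hg
  ⟨C + D, fun x => (abs_add_le _ _).trans (add_le_add (hC x) (hD x))⟩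

theorem const_mul (c : ℝ) (hf : BoundedFun f) : BoundedFun fun x => c * f x :=
  let ⟨C, hC⟩ := hf
  ⟨|c| * C, fun x => by
    rw [abs_mul]
    exact mul_le_mul_of_nonneg_left (hC x) (abs_nonneg c)⟩

theorem const (c : ℝ) : BoundedFun fun _ : X => c := ⟨|c|, fun _ => le_rfl⟩

theorem sub (hf : BoundedFun f) (hg : BoundedFun g) : BoundedFun fun x => f x - g x := by
  simpa only [neg_one_mul, ← sub_eq_add_neg] using hf.add (hg.const_mul (-1))

theorem indicator (A : Set X) : BoundedFun (A.indicator 1 : X → ℝ) :=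
  ⟨1, fun x => by by_cases h : x ∈ A <;> simp [h]⟩

end BoundedFun

/-- A mean on `X`: a functional on the real functions on `X` which on the bounded functions is
linear, positive and normalized. -/
structure IsMean {X : Type*} (m : (X → ℝ) → ℝ) : Prop where
  map_add : ∀ f g, BoundedFun f → BoundedFun g → m (fun x => f x + g x) = m f + m g
  map_mul : ∀ (c : ℝ) (f), BoundedFun f → m (fun x => c * f x) = c * m f
  nonneg : ∀ f, BoundedFun f → (∀ x, 0 ≤ f x) → 0 ≤ m f
  map_one : m (fun _ => 1) = 1

namespace IsMean

variable {X Y : Type*} {m : (X → ℝ) → ℝ} {f g : X → ℝ}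

theorem map_const (hm : IsMean m) (c : ℝ) : m (fun _ => c) = c := by
  have h := hm.map_mul c (fun _ => 1) (.const 1)
  rwa [hm.map_one, mul_one] at h

theorem map_sub (hm : IsMean m) (hf : BoundedFun f) (hg : BoundedFun g) :
    m (fun x => f x - g x) = m f - m g := by
  have h := hm.map_add f (fun x => (-1) * g x) hf (hg.const_mul _)
  rw [hm.map_mul _ _ hg] at h
  simpa only [neg_one_mul, ← sub_eq_add_neg] using h

theorem mono (hm : IsMean m) (hf : BoundedFun f) (hg : BoundedFun g) (h : ∀ x, f x ≤ g x) :
    m f ≤ m g := by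
  have := hm.nonneg _ (hg.sub hf) fun x => sub_nonneg.2 (h x)
  rw [hm.map_sub hg hf] at this
  exact sub_nonneg.1 this

theorem abs_le (hm : IsMean m) {C : ℝ} (h : ∀ x, |f x| ≤ C) : |m f| ≤ C := by
  have hf : BoundedFun f := ⟨C, h⟩
  rw [_root_.abs_le]
  constructor
  · rw [← hm.map_const (-C)]
    exact hm.mono (.const _) hf fun x => (_root_.abs_le.1 (h x)).1
  · rw [← hm.map_const C]
    exact hm.mono hf (.const _) fun x => (_root_.abs_le.1 (h x)).2

theorem abs_sub_le (hm : IsMean m) (hf : BoundedFun f) (hg : BoundedFun g) {C : ℝ}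
    (h : ∀ x, |f x - g x| ≤ C) : |m f - m g| ≤ C := by
  rw [← hm.map_sub hf hg]
  exact hm.abs_le h

theorem map_sum (hm : IsMean m) {ι : Type*} (s : Finset ι) (F : ι → X → ℝ)
    (hF : ∀ i, BoundedFun (F i)) : m (fun x => ∑ i ∈ s, F i x) = ∑ i ∈ s, m (F i) := by
  classical
  have hb : ∀ t : Finset ι, BoundedFun fun x => ∑ i ∈ t, F i x := by
    intro t
    induction t using Finset.induction_on with
    | empty => simpa using BoundedFun.const 0
    | insert a t ha ih => simpa only [Finset.sum_insert ha] using (hF a).add ih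
  induction s using Finset.induction_on with
  | empty => simpa using hm.map_const 0
  | insert a t ha ih =>
    simp only [Finset.sum_insert ha]
    rw [hm.map_add _ _ (hF a) (hb t), ih]

theorem boundedFun_apply {k : Y → (X → ℝ) → ℝ} (hk : ∀ y, IsMean (k y)) (hf : BoundedFun f) :
    BoundedFun fun y => k y f :=
  let ⟨C, hC⟩ := hf
  ⟨C, fun y => (hk y).abs_le hC⟩

/-- The mixture of a family of means along a mean. -/
theorem bind {n : (Y → ℝ) → ℝ} (hn : IsMean n) {k : Y → (X → ℝ) → ℝ} (hk : ∀ y, IsMean (k y)) :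
    IsMean fun f => n fun y => k y f where
  map_add f g hf hg := by
    simp only [fun y => (hk y).map_add f g hf hg]
    exact hn.map_add _ _ (boundedFun_apply hk hf) (boundedFun_apply hk hg)
  map_mul c f hf := by
    simp only [fun y => (hk y).map_mul c f hf]
    exact hn.map_mul _ _ (boundedFun_apply hk hf)
  nonneg f hf h := hn.nonneg _ (boundedFun_apply hk hf) fun y => (hk y).nonneg f hf h
  map_one := by
    simp only [fun y => (hk y).map_one]
    exact hn.map_one

theorem map (hm : IsMean m) (φ : X → Y) : IsMean fun f => m fun x => f (φ x) where
  map_add _ _ hf hg := hm.map_add _ _ (hf.comp φ) (hg.comp φ)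
  map_mul c _ hf := hm.map_mul c _ (hf.comp φ)
  nonneg _ hf h := hm.nonneg _ (hf.comp φ) fun x => h (φ x)
  map_one := hm.map_one

theorem dirac (x : X) : IsMean fun f : X → ℝ => f x where
  map_add _ _ _ _ := rfl
  map_mul _ _ _ := rfl
  nonneg _ _ h := h x
  map_one := rfl

/-- A finite convex combination of means. -/
theorem convex {ι : Type*} (s : Finset ι) (w : ι → ℝ) (hw : ∀ i ∈ s, 0 ≤ w i)
    (hw1 : ∑ i ∈ s, w i = 1) (k : ι → (X → ℝ) → ℝ) (hk : ∀ i, IsMean (k i)) :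
    IsMean fun f => ∑ i ∈ s, w i * k i f where
  map_add f g hf hg := by
    rw [← Finset.sum_add_distrib]
    exact Finset.sum_congr rfl fun i _ => by rw [(hk i).map_add f g hf hg, mul_add]
  map_mul c f hf := by
    rw [Finset.mul_sum]
    exact Finset.sum_congr rfl fun i _ => by rw [(hk i).map_mul c f hf]; ring
  nonneg f hf h := Finset.sum_nonneg fun i hi => mul_nonneg (hw i hi) ((hk i).nonneg f hf h)
  map_one := by simpa only [fun i => (hk i).map_one, mul_one] using hw1

/-- The average of finitely many means. -/
theorem average {ι : Type*} {s : Finset ι} (hs : s.Nonempty) (k : ι → (X → ℝ) → ℝ)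
    (hk : ∀ i, IsMean (k i)) : IsMean fun f => (∑ i ∈ s, k i f) / s.card := by
  have h0 : (s.card : ℝ) ≠ 0 := by exact_mod_cast hs.card_pos.ne'
  have := convex s (fun _ => (s.card : ℝ)⁻¹) (fun _ _ => by positivity)
    (by rw [Finset.sum_const, nsmul_eq_mul, mul_inv_cancel₀ h0]) k hk
  simpa only [← Finset.mul_sum, div_eq_inv_mul] using this

end IsMean

/-! ### Ultralimits of means -/

section Ultralimit

variable {ι X : Type*} (U : Ultrafilter ι)

theorem tendsto_limUnder_of_boundedFun {h : ι → ℝ} (hh : BoundedFun h) :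
    Tendsto h U (𝓝 (limUnder (U : Filter ι) h)) := by
  obtain ⟨C, hC⟩ := hh
  apply tendsto_nhds_limUnder
  have hc : IsCompact (Set.Icc (-C) C) := isCompact_Icc
  obtain ⟨x, -, hx⟩ := hc.ultrafilter_le_nhds (U.map h) (le_principal_iff.2
    (show ∀ᶠ i in (U : Filter ι), h i ∈ Set.Icc (-C) C from
      Eventually.of_forall fun i => abs_le.1 (hC i)))
  exact ⟨x, hx⟩

theorem isMean_limUnder {m : ι → (X → ℝ) → ℝ} (hm : ∀ i, IsMean (m i)) :
    IsMean fun f => limUnder (U : Filter ι) fun i => m i f where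
  map_add f g hf hg := by
    simp only [fun i => (hm i).map_add f g hf hg]
    exact ((tendsto_limUnder_of_boundedFun U (IsMean.boundedFun_apply hm hf)).add
      (tendsto_limUnder_of_boundedFun U (IsMean.boundedFun_apply hm hg))).limUnder_eq
  map_mul c f hf := by
    simp only [fun i => (hm i).map_mul c f hf]
    exact ((tendsto_limUnder_of_boundedFun U (IsMean.boundedFun_apply hm hf)).const_mul
      c).limUnder_eq
  nonneg f hf h := ge_of_tendsto
    (tendsto_limUnder_of_boundedFun U (IsMean.boundedFun_apply hm hf))
    (Eventually.of_forall fun i => (hm i).nonneg f hf h)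
  map_one := by
    simp only [fun i => (hm i).map_one]
    exact tendsto_const_nhds.limUnder_eq

theorem limUnder_eq_of_tendsto_sub {m : ι → (X → ℝ) → ℝ} (hm : ∀ i, IsMean (m i))
    {f g : X → ℝ} (hf : BoundedFun f) (hg : BoundedFun g)
    (h : Tendsto (fun i => m i f - m i g) U (𝓝 0)) :
    limUnder (U : Filter ι) (fun i => m i f) =
      limUnder (U : Filter ι) fun i => m i g := by
  have h' := (tendsto_limUnder_of_boundedFun U (IsMean.boundedFun_apply hm hf)).sub
    (tendsto_limUnder_of_boundedFun U (IsMean.boundedFun_apply hm hg))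
  exact sub_eq_zero.1 (tendsto_nhds_unique h' h)

end Ultralimit

/-- An ultralimit of the means turns asymptotic equalities along `l` into exact ones. This is how
every almost invariant family below becomes an invariant mean. -/
theorem exists_isMean_of_tendsto {ι X : Type*} (l : Filter ι) [l.NeBot] {p : ι → (X → ℝ) → ℝ}
    (hp : ∀ i, IsMean (p i)) : ∃ m : (X → ℝ) → ℝ, IsMean m ∧ ∀ f g, BoundedFun f → BoundedFun g →
      Tendsto (fun i => p i f - p i g) l (𝓝 0) → m f = m g :=
  ⟨_, isMean_limUnder (Ultrafilter.of l) hp, fun _ _ hf hg h =>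
    limUnder_eq_of_tendsto_sub _ hp hf hg (h.mono_left (Ultrafilter.of_le l))⟩

/-! ## Finitely additive measures and means -/

section FinitelyAdditive

variable {X : Type*} {μ : Set X → ℝ}

theorem sum_finitelyAdditive (h0 : μ ∅ = 0)
    (hadd : ∀ A B : Set X, Disjoint A B → μ (A ∪ B) = μ A + μ B)
    {ι : Type*} (s : Finset ι) (A : ι → Set X)
    (hA : ∀ i j, i ≠ j → Disjoint (A i) (A j)) :
    μ (⋃ i ∈ s, A i) = ∑ i ∈ s, μ (A i) := by
  classical
  induction s using Finset.induction_on with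
  | empty => simpa using h0
  | insert a s ha ih =>
    rw [Finset.set_biUnion_insert, hadd, ih, Finset.sum_insert ha]
    rw [Set.disjoint_iUnion₂_right]
    exact fun i hi => hA a i (by rintro rfl; exact ha hi)

open Classical in
/-- A finitely additive probability measure extends to a mean. -/
theorem exists_isMean_of_finitelyAdditive (hpos : ∀ A, 0 ≤ μ A) (huniv : μ Set.univ = 1)
    (hadd : ∀ A B : Set X, Disjoint A B → μ (A ∪ B) = μ A + μ B) :
    ∃ m : (X → ℝ) → ℝ, IsMean m ∧ ∀ A : Set X, m (A.indicator 1) = μ A := by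
  have h0 : μ ∅ = 0 := by
    have := hadd ∅ ∅ (Set.disjoint_empty _)
    rw [Set.union_empty] at this
    linarith
  have hX : Nonempty X := by
    by_contra h
    rw [not_nonempty_iff] at h
    rw [Set.univ_eq_empty_iff.2 h, h0] at huniv
    exact zero_ne_one huniv
  -- The atoms of the Boolean algebra generated by `P`: the part `Q` records which members of `P`
  -- contain the point.
  set atom : Finset (Set X) → Finset (Set X) → Set X :=
    fun P Q => {x | P.filter (x ∈ ·) = Q} with hatom
  have hdisj : ∀ P Q Q', Q ≠ Q' → Disjoint (atom P Q) (atom P Q') := by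
    intro P Q Q' hne
    rw [Set.disjoint_left]
    intro x hx hx'
    exact hne (hx.symm.trans hx')
  have hpt : ∀ P Q, ∃ x, (atom P Q).Nonempty → x ∈ atom P Q := by
    intro P Q
    by_cases h : (atom P Q).Nonempty
    · exact ⟨h.some, fun _ => h.some_mem⟩
    · exact ⟨hX.some, fun h' => absurd h' h⟩
  choose pt hpt using hpt
  -- A Riemann sum with one sample point per atom. The sample point of an empty atom is arbitrary,
  -- since such an atom has measure zero.
  set p : Finset (Set X) → (X → ℝ) → ℝ :=
    fun P f => ∑ Q ∈ P.powerset, μ (atom P Q) * f (pt P Q) with hp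
  have hsum : ∀ P (S : Finset (Finset (Set X))), μ (⋃ Q ∈ S, atom P Q) =
      ∑ Q ∈ S, μ (atom P Q) := fun P S => sum_finitelyAdditive h0 hadd S _ (hdisj P)
  have hmean : ∀ P, IsMean (p P) := by
    intro P
    refine IsMean.convex _ _ (fun Q _ => hpos _) ?_ (fun Q f => f (pt P Q))
      fun Q => IsMean.dirac _
    rw [← hsum, ← huniv]
    congr 1
    rw [Set.eq_univ_iff_forall]
    intro x
    exact Set.mem_biUnion (x := P.filter (x ∈ ·))
      (Finset.mem_coe.2 (Finset.mem_powerset.2 (Finset.filter_subset _ _))) rfl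
  refine ⟨_, isMean_limUnder (Ultrafilter.of atTop) hmean, fun A => ?_⟩
  refine Tendsto.limUnder_eq (tendsto_const_nhds.congr' ?_)
  refine (Ultrafilter.of_le atTop) ?_
  -- As soon as `A ∈ P`, the set `A` is a union of atoms and the Riemann sum of its indicator is
  -- exactly `μ A`.
  filter_upwards [eventually_ge_atTop ({A} : Finset (Set X))] with P hP
  have hAP : A ∈ P := hP (Finset.mem_singleton_self A)
  have hterm : ∀ Q ∈ P.powerset, μ (atom P Q) * A.indicator 1 (pt P Q) =
      if A ∈ Q then μ (atom P Q) else 0 := by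
    intro Q _
    by_cases hne : (atom P Q).Nonempty
    · have hmem : pt P Q ∈ atom P Q := hpt P Q hne
      have hiff : pt P Q ∈ A ↔ A ∈ Q := by
        have h := Finset.ext_iff.1 (show P.filter (pt P Q ∈ ·) = Q from hmem) A
        rw [← h, Finset.mem_filter]
        exact (and_iff_right hAP).symm
      by_cases hA : A ∈ Q <;> simp [hiff, hA]
    · rw [Set.not_nonempty_iff_eq_empty.1 hne, h0]
      simp
  change μ A = ∑ Q ∈ P.powerset, μ (atom P Q) * A.indicator 1 (pt P Q)
  rw [Finset.sum_congr rfl hterm, ← Finset.sum_filter, ← hsum]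
  congr 1
  ext x
  simp only [Finset.mem_filter, Finset.mem_powerset, Set.mem_iUnion, exists_prop, hatom,
    Set.mem_ofPred_eq]
  constructor
  · intro hx
    exact ⟨P.filter (x ∈ ·), ⟨Finset.filter_subset _ _, by simp [hAP, hx]⟩, rfl⟩
  · rintro ⟨Q, ⟨-, hAQ⟩, rfl⟩
    exact (Finset.mem_filter.1 hAQ).2

end FinitelyAdditive

/-- A bounded nonnegative function is uniformly close to a combination of indicators of its
superlevel sets. -/
theorem abs_sub_sum_indicator_le {X : Type*} {f : X → ℝ} (h0 : ∀ x, 0 ≤ f x)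
    (h1 : ∀ x, f x ≤ 1) {n : ℕ} (hn : 0 < n) (x : X) :
    |f x - ∑ k ∈ Finset.range n, (n : ℝ)⁻¹ * {y | ((k : ℝ) + 1) / n ≤ f y}.indicator 1 x| ≤
      (n : ℝ)⁻¹ := by
  have hn' : (0 : ℝ) < n := by exact_mod_cast hn
  have hfl : ⌊f x * n⌋₊ ≤ n := by
    refine Nat.floor_le_of_le ?_
    nlinarith [h1 x]
  have hsum : ∑ k ∈ Finset.range n, (n : ℝ)⁻¹ *
      {y | ((k : ℝ) + 1) / n ≤ f y}.indicator 1 x = (n : ℝ)⁻¹ * ⌊f x * n⌋₊ := by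
    rw [← Finset.mul_sum]
    congr 1
    have : ∀ k ∈ Finset.range n, ({y | ((k : ℝ) + 1) / n ≤ f y}.indicator 1 x : ℝ) =
        if k < ⌊f x * n⌋₊ then 1 else 0 := by
      intro k _
      have hiff : ((k : ℝ) + 1) / n ≤ f x ↔ k < ⌊f x * n⌋₊ := by
        rw [div_le_iff₀ hn', ← Nat.succ_le_iff, Nat.le_floor_iff (by have := h0 x; positivity)]
        push_cast
        rfl
      by_cases h : k < ⌊f x * n⌋₊
      · rw [if_pos h]
        exact Set.indicator_of_mem (s := {y | ((k : ℝ) + 1) / n ≤ f y}) (hiff.2 h) _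
      · rw [if_neg h]
        exact Set.indicator_of_notMem (s := {y | ((k : ℝ) + 1) / n ≤ f y})
          (fun h' => h (hiff.1 h')) _
    rw [Finset.sum_congr rfl this, ← Finset.sum_filter, Finset.sum_const, nsmul_eq_mul, mul_one]
    have : (Finset.range n).filter (· < ⌊f x * n⌋₊) = Finset.range ⌊f x * n⌋₊ := by
      ext k
      simp only [Finset.mem_filter, Finset.mem_range]
      omega
    rw [this, Finset.card_range]
  rw [hsum]
  have ha := Nat.floor_le (show 0 ≤ f x * n by have := h0 x; positivity)
  have hb := Nat.lt_floor_add_one (f x * n)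
  rw [show f x - (n : ℝ)⁻¹ * ⌊f x * n⌋₊ = (n : ℝ)⁻¹ * (f x * n - ⌊f x * n⌋₊) by
    field_simp, abs_of_nonneg (mul_nonneg (by positivity) (by linarith))]
  exact mul_le_of_le_one_right (by positivity) (by linarith)

/-- Two means which agree on indicators agree on bounded functions. -/
theorem IsMean.eq_of_indicator {X : Type*} {m m' : (X → ℝ) → ℝ} (hm : IsMean m)
    (hm' : IsMean m') (h : ∀ A : Set X, m (A.indicator 1) = m' (A.indicator 1)) {f : X → ℝ}
    (hf : BoundedFun f) : m f = m' f := by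
  have key : ∀ f : X → ℝ, (∀ x, 0 ≤ f x) → (∀ x, f x ≤ 1) → m f = m' f := by
    intro f h0 h1
    have hfb : BoundedFun f := ⟨1, fun x => by rw [abs_of_nonneg (h0 x)]; exact h1 x⟩
    -- Both means take the same value on the step function lying within `1 / n` of `f`.
    have hle : ∀ n : ℕ, 0 < n → |m f - m' f| ≤ 2 * (n : ℝ)⁻¹ := by
      intro n hn
      have hb : ∀ k : ℕ, BoundedFun fun x =>
          (n : ℝ)⁻¹ * ({y | ((k : ℝ) + 1) / n ≤ f y}.indicator 1 x : ℝ) :=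
        fun k => (BoundedFun.indicator _).const_mul _
      have hsb : BoundedFun fun x => ∑ k ∈ Finset.range n,
          (n : ℝ)⁻¹ * ({y | ((k : ℝ) + 1) / n ≤ f y}.indicator 1 x : ℝ) := by
        obtain ⟨C, hC⟩ := hfb
        refine ⟨C + (n : ℝ)⁻¹, fun x => ?_⟩
        have := abs_sub_sum_indicator_le h0 h1 hn x
        have h2 := hC x
        rw [abs_sub_comm] at this
        calc _ = |(_ - f x) + f x| := by rw [sub_add_cancel]
          _ ≤ _ := (abs_add_le _ _).trans (by linarith)
      have e1 := hm.abs_sub_le hfb hsb (abs_sub_sum_indicator_le h0 h1 hn)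
      have e2 := hm'.abs_sub_le hfb hsb (abs_sub_sum_indicator_le h0 h1 hn)
      rw [hm.map_sum _ _ hb] at e1
      rw [hm'.map_sum _ _ hb] at e2
      simp only [fun A => hm.map_mul (n : ℝ)⁻¹ _ (BoundedFun.indicator A), h] at e1
      simp only [fun A => hm'.map_mul (n : ℝ)⁻¹ _ (BoundedFun.indicator A)] at e2
      rw [abs_sub_comm] at e2
      have := _root_.abs_sub_le (m f) (∑ k ∈ Finset.range n,
        (n : ℝ)⁻¹ * m' ({y | ((k : ℝ) + 1) / n ≤ f y}.indicator 1)) (m' f)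
      linarith
    have hlim : Tendsto (fun n : ℕ => 2 * (n : ℝ)⁻¹) atTop (𝓝 (2 * 0)) :=
      tendsto_inv_atTop_nhds_zero_nat.const_mul 2
    rw [mul_zero] at hlim
    have := ge_of_tendsto hlim ((eventually_gt_atTop 0).mono hle)
    exact sub_eq_zero.1 (abs_eq_zero.1 (le_antisymm this (abs_nonneg _)))
  obtain ⟨C, hC⟩ := hf
  set D : ℝ := |C| + 1 with hD
  have hD0 : 0 < D := by positivity
  have hCD : ∀ x, |f x| ≤ D := fun x => (hC x).trans (by rw [hD]; linarith [le_abs_self C])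
  set g : X → ℝ := fun x => (2 * D)⁻¹ * (f x + D) with hg
  have hgb : BoundedFun g := ((show BoundedFun f from ⟨C, hC⟩).add (.const D)).const_mul _
  have hfg : f = fun x => 2 * D * g x + -D := by
    funext x
    simp only [hg]
    field_simp
    ring
  have hgm : m g = m' g := by
    refine key g (fun x => ?_) fun x => ?_
    · have := (_root_.abs_le.1 (hCD x)).1
      exact mul_nonneg (by positivity) (by linarith)
    · have := (_root_.abs_le.1 (hCD x)).2
      simp only [hg]
      rw [inv_mul_le_iff₀ (by positivity)]
      linarith
  rw [hfg, hm.map_add _ _ (hgb.const_mul _) (.const _),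
    hm'.map_add _ _ (hgb.const_mul _) (.const _), hm.map_mul _ _ hgb, hm'.map_mul _ _ hgb, hgm,
    hm.map_const, hm'.map_const]

/-- A mean is invariant if it is not changed by translations of bounded functions. -/
def IsMean.Invariant (G : Type*) {X : Type*} [Group G] [MulAction G X] (m : (X → ℝ) → ℝ) : Prop :=
  ∀ (g : G) (f : X → ℝ), BoundedFun f → m (fun x => f (g • x)) = m f

/-- Since means are determined by their values on indicators, invariance on sets passes to bounded
functions. Unlike measures, functionals can be mixed directly by `IsMean.bind`. -/
theorem isAmenableAction_iff {G X : Type*} [Group G] [MulAction G X] :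
    IsAmenableAction G X ↔ ∃ m : (X → ℝ) → ℝ, IsMean m ∧ IsMean.Invariant G m := by
  classical
  constructor
  · rintro ⟨μ, hμ⟩
    obtain ⟨m, hm, hmμ⟩ := exists_isMean_of_finitelyAdditive
      (fun A => (hμ.mem_unitInterval A).1) hμ.total hμ.additive
    refine ⟨m, hm, fun g f hf => ?_⟩
    refine (hm.map (g • ·)).eq_of_indicator hm (fun A => ?_) hf
    rw [hmμ, ← hμ.invariant g⁻¹, ← hmμ]
    congr 1
    funext x
    rw [Set.indicator_apply, Set.indicator_apply]
    refine if_congr ⟨fun h => ⟨g • x, h, inv_smul_smul g x⟩, ?_⟩ rfl rfl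
    rintro ⟨y, hy, rfl⟩
    rwa [smul_inv_smul]
  · rintro ⟨m, hm, hinv⟩
    refine ⟨fun A => m (A.indicator 1), ⟨fun A => ⟨?_, ?_⟩, ?_, fun A B hAB => ?_, fun g A => ?_⟩⟩
    · exact hm.nonneg _ (.indicator A) fun x => Set.indicator_nonneg (fun _ _ => zero_le_one) x
    · rw [← hm.map_one]
      exact hm.mono (.indicator A) (.const 1)
        fun x => Set.indicator_le_self' (fun _ _ => zero_le_one) x
    · rw [Set.indicator_univ]
      exact hm.map_one
    · rw [← hm.map_add _ _ (.indicator A) (.indicator B)]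
      congr 1
      exact Set.indicator_union_of_disjoint hAB _
    · rw [← hinv g _ (.indicator _)]
      congr 1
      funext x
      rw [Set.indicator_apply, Set.indicator_apply]
      refine if_congr ⟨?_, fun h => ⟨x, h, rfl⟩⟩ rfl rfl
      rintro ⟨y, hy, h⟩
      rwa [← smul_left_cancel g h]

/-! ## Amenable groups -/

section Amenable

variable {G : Type*} [Group G]

/-- Keep the mean at one representative of each orbit and transport it along the orbit. Two
transporters to the same point differ by a stabilizer element, so stabilizer invariance makes the
result equivariant. The sets `D y` record where the means are concentrated. -/
theorem exists_equivariant_means {Y M : Type*} [MulAction G Y] [MulAction G M]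
    (N : Y → (M → ℝ) → ℝ) (hN : ∀ y, IsMean (N y))
    (hinv : ∀ y, ∀ g ∈ MulAction.stabilizer G y, ∀ f, BoundedFun f →
      N y (fun s => f (g • s)) = N y f)
    (D : Y → Set M) (hD : ∀ (g : G) y, ∀ s ∈ D y, g • s ∈ D (g • y))
    (hND : ∀ y f f', Set.EqOn f f' (D y) → N y f = N y f') :
    ∃ m : Y → (M → ℝ) → ℝ, (∀ y, IsMean (m y)) ∧
      (∀ (g : G) y f, BoundedFun f → m (g • y) f = m y (fun s => f (g • s))) ∧
      ∀ y f f', Set.EqOn f f' (D y) → m y f = m y f' := by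
  set r : Y → Y := fun y => (Quotient.mk (MulAction.orbitRel G Y) y).out with hr
  have hrel : ∀ y, ∃ g : G, g • r y = y := by
    intro y
    have h : (MulAction.orbitRel G Y).r y (r y) :=
      (MulAction.orbitRel G Y).symm (Quotient.mk_out (s := MulAction.orbitRel G Y) y)
    exact h
  have hrg : ∀ (g : G) y, r (g • y) = r y := by
    intro g y
    simp only [hr]
    congr 1
    exact Quotient.sound (s := MulAction.orbitRel G Y) ⟨g, rfl⟩
  choose t ht using hrel
  refine ⟨fun y f => N (r y) fun s => f (t y • s), fun y => (hN _).map _, ?_, ?_⟩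
  · intro g y f hf
    have hk : (g * t y)⁻¹ * t (g • y) ∈ MulAction.stabilizer G (r y) := by
      have h1 := ht (g • y)
      rw [hrg] at h1
      rw [MulAction.mem_stabilizer_iff, mul_smul, h1, inv_smul_eq_iff, mul_smul, ht]
    have h := hinv _ _ hk (fun s => f ((g * t y) • s)) (hf.comp _)
    simp only [smul_smul, mul_inv_cancel_left] at h
    simp only [hrg, smul_smul]
    exact h
  · intro y f f' h
    refine hND _ _ _ fun s hs => h ?_
    have := hD (t y) _ s hs
    rwa [ht] at this

/-- A group with an amenable action all of whose stabilizers are amenable is amenable. -/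
theorem isAmenableGroup_of_stabilizers {Ω : Type*} [MulAction G Ω] {m : (Ω → ℝ) → ℝ}
    (hm : IsMean m) (hinv : IsMean.Invariant G m)
    (hstab : ∀ ω : Ω, IsAmenableGroup (MulAction.stabilizer G ω)) : IsAmenableGroup G := by
  have h : ∀ ω : Ω, ∃ n : (MulAction.stabilizer G ω → ℝ) → ℝ, IsMean n ∧
      IsMean.Invariant (MulAction.stabilizer G ω) n := fun ω => isAmenableAction_iff.1 (hstab ω)
  choose n hn hninv using h
  obtain ⟨k, hk, hkinv, -⟩ := exists_equivariant_means (G := G) (M := G)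
    (fun ω f => n ω fun s => f s) (fun ω => (hn ω).map _)
    (fun ω g hg f hf => hninv ω ⟨g, hg⟩ (fun s => f s) (hf.comp _))
    (fun _ => Set.univ) (fun _ _ _ _ => trivial)
    (fun ω f f' hff' => by rw [(Set.eqOn_univ f f').1 hff'])
  refine isAmenableAction_iff.2 ⟨_, hm.bind hk, fun g f hf => ?_⟩
  rw [← hinv g _ (IsMean.boundedFun_apply hk hf)]
  congr 1
  funext ω
  exact (hkinv g ω f hf).symm

/-- The elements leaving a mean invariant. -/
def IsMean.invariantSubgroup {X : Type*} [MulAction G X] (m : (X → ℝ) → ℝ) : Subgroup G where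
  carrier := {g | ∀ f, BoundedFun f → m (fun x => f (g • x)) = m f}
  one_mem' f _ := by simp only [one_smul]
  mul_mem' {a b} ha hb f hf := by
    have h := hb (fun x => f (a • x)) (hf.comp _)
    simp only [mul_smul]
    rw [h, ha f hf]
  inv_mem' {a} ha f hf := by
    have := ha (fun x => f (a⁻¹ • x)) (hf.comp _)
    simp only [inv_smul_smul] at this
    exact this.symm

/-- The union of an increasing sequence of finite groups is amenable. -/
theorem isAmenableGroup_of_monotone_finite (K : ℕ → Subgroup G) (hK : Monotone K)
    (hfin : ∀ n, Finite (K n)) (h : ∀ g, ∃ n, g ∈ K n) : IsAmenableGroup G := by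
  have : ∀ n, Fintype (K n) := fun n => Fintype.ofFinite _
  set p : ℕ → (G → ℝ) → ℝ := fun n f =>
    (∑ k : K n, f k) / (Finset.univ : Finset (K n)).card with hp
  have hmean : ∀ n, IsMean (p n) := fun n =>
    IsMean.average ⟨1, Finset.mem_univ _⟩ (fun (k : K n) (f : G → ℝ) => f k)
      fun k => IsMean.dirac (k : G)
  obtain ⟨m, hm, hm'⟩ := exists_isMean_of_tendsto atTop hmean
  refine isAmenableAction_iff.2 ⟨m, hm, fun g f hf => hm' _ _ (hf.comp _) hf ?_⟩
  obtain ⟨n, hn⟩ := h g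
  refine tendsto_const_nhds.congr' ?_
  filter_upwards [eventually_ge_atTop n] with i hi
  rw [eq_comm, sub_eq_zero]
  simp only [hp]
  congr 1
  exact Fintype.sum_equiv (Equiv.mulLeft ⟨g, hK hi hn⟩) _ _ fun _ => rfl

/-- Averages over `c ^ 0, …, c ^ n` change under translation by the generator only through the two
end terms. Invariance under the generator suffices, because the elements leaving a mean invariant
form a subgroup. -/
theorem isAmenableGroup_of_isCyclic [IsCyclic G] : IsAmenableGroup G := by
  obtain ⟨c, hc⟩ := IsCyclic.exists_generator (α := G)
  set p : ℕ → (G → ℝ) → ℝ := fun n f =>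
    (∑ i ∈ Finset.range (n + 1), f (c ^ i)) / (Finset.range (n + 1)).card with hp
  have hmean : ∀ n, IsMean (p n) := fun n =>
    IsMean.average ⟨0, by simp⟩ (fun (i : ℕ) f => f (c ^ i)) fun k => IsMean.dirac _
  obtain ⟨m, hm, hm'⟩ := exists_isMean_of_tendsto atTop hmean
  have hmem : c ∈ IsMean.invariantSubgroup (X := G) m := by
    intro f hf
    refine hm' _ _ (hf.comp _) hf ?_
    obtain ⟨C, hC⟩ := hf
    have hlim : Tendsto (fun n : ℕ => (2 * C) * (((n : ℝ) + 1)⁻¹)) atTop (𝓝 0) := by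
      have := (tendsto_inv_atTop_nhds_zero_nat (𝕜 := ℝ)).comp (tendsto_add_atTop_nat 1)
      have := this.const_mul (2 * C)
      simpa [Function.comp_def] using this
    refine squeeze_zero_norm (fun n => ?_) hlim
    simp only [hp]
    rw [← sub_div, ← Finset.sum_sub_distrib]
    have : ∑ i ∈ Finset.range (n + 1), (f (c • c ^ i) - f (c ^ i)) =
        f (c ^ (n + 1)) - f (c ^ 0) := by
      rw [← Finset.sum_range_sub (fun i => f (c ^ i))]
      exact Finset.sum_congr rfl fun i _ => by rw [smul_eq_mul, ← pow_succ']
    rw [this, Finset.card_range, Real.norm_eq_abs, abs_div, div_eq_mul_inv, Nat.cast_add,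
      Nat.cast_one, abs_of_nonneg (show (0 : ℝ) ≤ n + 1 by positivity)]
    refine mul_le_mul_of_nonneg_right ?_ (by positivity)
    refine (abs_sub _ _).trans ?_
    linarith [hC (c ^ (n + 1)), hC (c ^ 0)]
  refine isAmenableAction_iff.2 ⟨m, hm, fun g => ?_⟩
  exact (Subgroup.zpowers_le.2 hmem) (hc g)

theorem IsAmenableGroup.of_mulEquiv {H : Type*} [Group H] (e : G ≃* H) (hG : IsAmenableGroup G) :
    IsAmenableGroup H := by
  obtain ⟨m, hm, hinv⟩ := isAmenableAction_iff.1 hG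
  refine isAmenableAction_iff.2 ⟨_, hm.map e, fun h f hf => ?_⟩
  rw [← hinv (e.symm h) _ (hf.comp e)]
  simp only [smul_eq_mul, map_mul, MulEquiv.apply_symm_apply]

end Amenable

/-! ## Free groups -/

namespace FreeGroup

variable {α : Type*}

/-- Take a generator `x` different from the first letter of `z`. Then `x * z` is reduced and begins
with `x`, whereas `z * x` has the same length and so begins with the first letter of `z`. -/
theorem eq_one_of_commute_all [DecidableEq α] {a b : α} (hab : a ≠ b) {z : FreeGroup α}
    (hz : ∀ x, Commute x z) : z = 1 := by
  by_contra hne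
  rw [← toWord_eq_nil_iff] at hne
  obtain ⟨s, L, hL⟩ := List.exists_cons_of_ne_nil hne
  obtain ⟨x, hx⟩ : ∃ x : α, x ≠ s.1 := by
    by_cases h : a = s.1
    · exact ⟨b, by rw [← h]; exact hab.symm⟩
    · exact ⟨a, h⟩
  have hred : IsReduced (s :: L) := hL ▸ isReduced_toWord
  have h1 : (of x * z).toWord = (x, true) :: s :: L := by
    rw [toWord_mul, toWord_of, hL]
    refine IsReduced.reduce_eq ?_
    exact isReduced_cons_cons.2 ⟨fun h => absurd h hx, hred⟩
  have h2 : (z * of x).toWord = s :: L ++ [(x, true)] := by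
    have hsub := toWord_mul_sublist z (of x)
    rw [hL, toWord_of] at hsub
    refine hsub.eq_of_length ?_
    rw [← (hz (of x)).eq, h1]
    simp
  rw [(hz (of x)).eq, h2] at h1
  have := (List.cons.inj h1).1
  exact hx (by rw [this])

/-- The words beginning with `x⁻¹`, together with a translate of those beginning with `x`, cover the
group, so the words beginning with `x` or `x⁻¹` have mass at least one. Two generators would give
disjoint sets of total mass at least two. -/
theorem not_isAmenableGroup [DecidableEq α] {a b : α} (hab : a ≠ b) :
    ¬ IsAmenableGroup (FreeGroup α) := by
  rintro ⟨μ, hμ⟩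
  have h0 : ∀ A, 0 ≤ μ A := fun A => (hμ.mem_unitInterval A).1
  have hmono : ∀ A B : Set (FreeGroup α), A ⊆ B → μ A ≤ μ B := by
    intro A B h
    rw [← Set.union_sdiff_cancel h, hμ.additive _ _ Set.disjoint_sdiff_right]
    linarith [h0 (B \ A)]
  have hsub : ∀ A B : Set (FreeGroup α), μ (A ∪ B) ≤ μ A + μ B := by
    intro A B
    rw [← Set.union_sdiff_self, hμ.additive _ _ Set.disjoint_sdiff_right]
    linarith [hmono _ _ (Set.sdiff_subset : B \ A ⊆ B)]
  have hpair : ∀ x : α, 1 ≤ μ (startsWith (x, true)) + μ (startsWith (x, false)) := by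
    intro x
    rw [← hμ.total, ← hμ.invariant (mk [(x, true)])⁻¹ (startsWith (x, true))]
    refine le_trans (hmono _ _ fun g _ => ?_) (hsub _ _)
    by_cases h : g ∈ startsWith (x, false)
    · exact Or.inr h
    · exact Or.inl ⟨mk [(x, true)] * g, startsWith_mk_mul (w := (x, true)) g h,
        inv_mul_cancel_left _ _⟩
  have hd : ∀ w w' : α × Bool, w ≠ w' →
      Disjoint (startsWith w) (startsWith w' : Set (FreeGroup α)) :=
    fun w w' h => startsWith.disjoint_iff_ne.2 h
  have h1 := hμ.additive _ _ (hd (a, true) (a, false) (by simp))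
  have h2 := hμ.additive _ _ (hd (b, true) (b, false) (by simp))
  have h3 := hμ.additive (startsWith (a, true) ∪ startsWith (a, false))
    (startsWith (b, true) ∪ startsWith (b, false)) (by
      simp only [Set.disjoint_union_left, Set.disjoint_union_right]
      refine ⟨⟨hd _ _ ?_, hd _ _ ?_⟩, hd _ _ ?_, hd _ _ ?_⟩ <;> simp [hab])
  have h4 := (hμ.mem_unitInterval
    (startsWith (a, true) ∪ startsWith (a, false) ∪ (startsWith (b, true) ∪
      startsWith (b, false)))).2
  linarith [hpair a, hpair b]

theorem isCyclic_of_subsingleton [Subsingleton α] : IsCyclic (FreeGroup α) := by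
  rcases isEmpty_or_nonempty α with h | ⟨⟨a⟩⟩
  · exact _root_.isCyclic_of_subsingleton
  · refine ⟨⟨of a, fun x => ?_⟩⟩
    have h : (⊤ : Subgroup (FreeGroup α)) ≤ Subgroup.zpowers (of a) := by
      rw [← closure_range_of, Subgroup.closure_le]
      rintro _ ⟨y, rfl⟩
      rw [Subsingleton.elim y a]
      exact Subgroup.mem_zpowers _
    exact h (Subgroup.mem_top x)

end FreeGroup

namespace IsFreeGroup

variable {F : Type*} [Group F] [IsFreeGroup F]

theorem isCyclic_of_commute (h : ∀ a b : F, Commute a b) : IsCyclic F := by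
  have hs : Subsingleton (Generators F) := by
    classical
    refine ⟨fun a b => ?_⟩
    by_contra hab
    have h1 := FreeGroup.eq_one_of_commute_all hab (z := FreeGroup.of a) fun x => by
      have := (h ((mulEquiv F) x) ((mulEquiv F) (FreeGroup.of a))).map (mulEquiv F).symm
      simpa using this
    exact FreeGroup.of_ne_one a h1
  have := FreeGroup.isCyclic_of_subsingleton (α := Generators F)
  exact isCyclic_of_surjective (mulEquiv F) (mulEquiv F).surjective

theorem exists_generators_ne {a b : F} (hab : ¬ Commute a b) :
    ∃ x y : Generators F, x ≠ y := by
  by_contra! h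
  have : Subsingleton (Generators F) := ⟨h⟩
  have := FreeGroup.isCyclic_of_subsingleton (α := Generators F)
  have hc : IsCyclic F := isCyclic_of_surjective (mulEquiv F) (mulEquiv F).surjective
  obtain ⟨g, hg⟩ := hc.exists_generator
  obtain ⟨i, rfl⟩ := hg a
  obtain ⟨j, rfl⟩ := hg b
  exact hab ((Commute.refl g).zpow_zpow i j)

theorem not_isAmenableGroup {a b : F} (hab : ¬ Commute a b) : ¬ IsAmenableGroup F := by
  classical
  obtain ⟨x, y, hxy⟩ := exists_generators_ne hab
  exact fun h => FreeGroup.not_isAmenableGroup hxy (h.of_mulEquiv (mulEquiv F).symm)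

theorem eq_one_of_commute_all {a b : F} (hab : ¬ Commute a b) {z : F} (hz : ∀ x, Commute x z) :
    z = 1 := by
  classical
  obtain ⟨x, y, hxy⟩ := exists_generators_ne hab
  have := FreeGroup.eq_one_of_commute_all hxy (z := (mulEquiv F).symm z) fun x => by
    simpa using (hz ((mulEquiv F) x)).map (mulEquiv F).symm
  simpa using this

/-- The centralizer of `x` is free by Nielsen–Schreier and has the non-trivial central element `x`,
so it is abelian. -/
theorem commute_trans {x y z : F} (hx : x ≠ 1) (hy : Commute x y) (hz : Commute x z) :
    Commute y z := by
  by_contra h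
  have hmem : ∀ w, Commute x w → w ∈ Subgroup.centralizer {x} := by
    intro w hw
    rw [Subgroup.mem_centralizer_singleton_iff]
    exact hw.symm.eq
  have := eq_one_of_commute_all (F := Subgroup.centralizer {x}) (a := ⟨y, hmem y hy⟩)
    (b := ⟨z, hmem z hz⟩) (fun h' => h (congrArg Subtype.val h'))
    (z := ⟨x, hmem x (Commute.refl x)⟩) fun w => Subtype.ext
      (Subgroup.mem_centralizer_singleton_iff.1 w.2)
  exact hx (congrArg Subtype.val this)

theorem isMulTorsionFree : IsMulTorsionFree F := by
  refine ⟨fun n hn a b h => ?_⟩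
  have h' : (mulEquiv F).symm a ^ n = (mulEquiv F).symm b ^ n := by
    rw [← map_pow, ← map_pow]
    exact congrArg _ h
  exact (mulEquiv F).symm.injective (pow_left_injective hn h')

/-- The elements of an abelian normal subgroup of a free group are central. -/
theorem commute_of_normal_commutative (N : Subgroup F) [N.Normal]
    (hN : ∀ x ∈ N, ∀ y ∈ N, Commute x y) {x : F} (hx : x ∈ N) (hx1 : x ≠ 1) (g : F) :
    Commute x g := by
  have := isMulTorsionFree (F := F)
  have hcyc : IsCyclic (Subgroup.centralizer {x}) := isCyclic_of_commute fun a b =>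
    Subtype.ext (commute_trans hx1 (Subgroup.mem_centralizer_singleton_iff.1 a.2).symm
      (Subgroup.mem_centralizer_singleton_iff.1 b.2).symm).eq
  obtain ⟨⟨c, hc⟩, hgen⟩ := hcyc.exists_generator
  have hxc : Commute x c := (Subgroup.mem_centralizer_singleton_iff.1 hc).symm
  have hpow : ∀ w, Commute x w → ∃ k : ℤ, c ^ k = w := by
    intro w hw
    obtain ⟨k, hk⟩ := hgen ⟨w, Subgroup.mem_centralizer_singleton_iff.2 hw.symm⟩
    exact ⟨k, congrArg Subtype.val hk⟩
  have hc1 : c ≠ 1 := by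
    rintro rfl
    obtain ⟨k, hk⟩ := hpow x (Commute.refl x)
    rw [one_zpow] at hk
    exact hx1 hk.symm
  -- The conjugates of `x` stay in the abelian group `N`, hence commute with `x`; by transitivity of
  -- commutation, conjugation preserves the cyclic centralizer of `x`.
  have hconj : ∀ g : F, ∃ k : ℤ, c ^ k = g * c * g⁻¹ := by
    intro g
    apply hpow
    have h1 : Commute (g * x * g⁻¹) x := hN _ (Subgroup.Normal.conj_mem ‹_› x hx g) _ hx
    have h2 : Commute (g * x * g⁻¹) (g * c * g⁻¹) := by
      have := hxc.map (MulAut.conj g)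
      simpa using this
    exact commute_trans (by simpa using hx1) h1 h2
  obtain ⟨k, hk⟩ := hconj g
  obtain ⟨l, hl⟩ := hconj g⁻¹
  have hkl : c ^ (l * k) = c ^ (1 : ℤ) := by
    rw [zpow_mul, hl, conj_zpow, hk]
    group
  have hkl' : l * k - 1 = 0 := by
    rw [← IsMulTorsionFree.zpow_eq_one_iff_right hc1, zpow_sub, hkl, mul_inv_cancel]
  -- The exponents for `g` and `g⁻¹` are mutually inverse integers, so `g` centralizes or inverts
  -- `c`. If it inverts `c`, then `g ^ 2` commutes with both `c` and `g`, which therefore commute.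
  have hcg : Commute c g := by
    rcases Int.isUnit_iff.1 (IsUnit.of_mul_eq_one_right l (sub_eq_zero.1 hkl')) with rfl | rfl
    · rw [zpow_one, eq_mul_inv_iff_mul_eq] at hk
      exact hk
    · by_cases hg1 : g = 1
      · rw [hg1]
        exact Commute.one_right c
      · have hg2 : g ^ 2 ≠ 1 := by
          rw [Ne, pow_eq_one_iff_left two_ne_zero]
          exact hg1
        refine commute_trans hg2 ?_ ((Commute.refl g).pow_left 2)
        have h2 : g * c⁻¹ * g⁻¹ = c := by
          rw [← conj_inv, ← hk, zpow_neg_one, inv_inv]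
        change g ^ 2 * c = c * g ^ 2
        rw [← mul_inv_eq_iff_eq_mul]
        calc g ^ 2 * c * (g ^ 2)⁻¹ = g * (g * c * g⁻¹) * g⁻¹ := by
              simp only [pow_two, mul_inv_rev, mul_assoc]
          _ = c := by rw [← hk, zpow_neg_one, h2]
  exact commute_trans hc1 hxc.symm hcg

/-- Non-trivial normal subgroups of a non-abelian free group intersect non-trivially. -/
theorem inf_ne_bot {a b : F} (hab : ¬ Commute a b) {M N : Subgroup F} [hMn : M.Normal]
    [hNn : N.Normal] (hM : M ≠ ⊥) (hN : N ≠ ⊥) : M ⊓ N ≠ ⊥ := by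
  intro h
  obtain ⟨x, hx, hx1⟩ := M.bot_or_exists_ne_one.resolve_left hM
  obtain ⟨y, hy, hy1⟩ := N.bot_or_exists_ne_one.resolve_left hN
  -- Disjoint normal subgroups commute, so `M` centralizes `y` and is abelian. Its non-trivial
  -- elements are then central in `F`.
  have hcomm : ∀ u ∈ M, Commute y u := fun u hu =>
    (Subgroup.commute_of_normal_of_disjoint M N hMn hNn (disjoint_iff.2 h) u y hu hy).symm
  have := commute_of_normal_commutative M
    (fun u hu v hv => commute_trans hy1 (hcomm u hu) (hcomm v hv)) hx hx1
  exact hab (commute_trans hx1 (this a) (this b))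

theorem iInf_ne_bot {a b : F} (hab : ¬ Commute a b) {ι : Type*} (s : Finset ι)
    (N : ι → Subgroup F) (hn : ∀ i, (N i).Normal) (hN : ∀ i, N i ≠ ⊥) :
    ⨅ i ∈ s, N i ≠ ⊥ := by
  classical
  induction s using Finset.induction_on with
  | empty =>
    simp only [Finset.notMem_empty, iInf_false, iInf_top]
    intro h
    have h1 : ∀ x : F, x = 1 := fun x => Subgroup.mem_bot.1 (h ▸ Subgroup.mem_top x)
    exact hab (by rw [h1 a, h1 b])
  | insert i s _ ih =>
    rw [Finset.iInf_insert]
    have : (⨅ j ∈ s, N j).Normal :=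
      Subgroup.normal_iInf_normal fun j => Subgroup.normal_iInf_normal fun _ => hn j
    have := hn i
    exact inf_ne_bot hab (hN i) ih

end IsFreeGroup

/-! ## Random finite subsets -/

section RandomSubset

variable {X : Type*} [DecidableEq X]

/-- The amplitude of `A` for the random subset of `T` containing each `x ∈ T` independently with
probability `sin² (θ x)`. -/
noncomputable def subsetAmplitude (θ : X → ℝ) (T A : Finset X) : ℝ :=
  (∏ x ∈ A, Real.sin (θ x)) * ∏ x ∈ T \ A, Real.cos (θ x)

/-- The expectation over the random subset of `T` containing each `x ∈ T` independently with
probability `sin² (θ x)`. -/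
noncomputable def subsetExpectation (θ : X → ℝ) (T : Finset X) (f : Finset X → ℝ) : ℝ :=
  ∑ A ∈ T.powerset, subsetAmplitude θ T A ^ 2 * f A

/-- Expand the product of `sin θ sin θ' + cos θ cos θ'` over subsets. This is the Hellinger affinity
of the two random subsets, and parametrizing probabilities by angles makes it depend only on angle
differences. -/
theorem sum_subsetAmplitude_mul (θ θ' : X → ℝ) (T : Finset X) :
    ∑ A ∈ T.powerset, subsetAmplitude θ T A * subsetAmplitude θ' T A =
      ∏ x ∈ T, Real.cos (θ x - θ' x) := by
  have h : ∀ x ∈ T, Real.cos (θ x - θ' x) =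
      Real.sin (θ x) * Real.sin (θ' x) + Real.cos (θ x) * Real.cos (θ' x) := fun x _ => by
    rw [Real.cos_sub, add_comm]
  rw [Finset.prod_congr rfl h, Finset.prod_add]
  refine Finset.sum_congr rfl fun A _ => ?_
  rw [subsetAmplitude, subsetAmplitude, Finset.prod_mul_distrib, Finset.prod_mul_distrib]
  ring

theorem sum_subsetAmplitude_sq (θ : X → ℝ) (T : Finset X) :
    ∑ A ∈ T.powerset, subsetAmplitude θ T A ^ 2 = 1 := by
  simp only [pow_two, sum_subsetAmplitude_mul, sub_self, Real.cos_zero, Finset.prod_const_one]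

theorem isMean_subsetExpectation (θ : X → ℝ) (T : Finset X) :
    IsMean (subsetExpectation θ T) :=
  IsMean.convex _ _ (fun _ _ => sq_nonneg _) (sum_subsetAmplitude_sq θ T)
    (fun A (f : Finset X → ℝ) => f A) fun A => IsMean.dirac A

/-- Factor `w² - w'²` as `(w - w') (w + w')` and apply Cauchy–Schwarz; the square norms of the
factors are at most `2ε` and `4`. -/
theorem abs_subsetExpectation_sub_le (θ θ' : X → ℝ) (T : Finset X) {f : Finset X → ℝ} {C : ℝ}
    (hC : 0 ≤ C) (hf : ∀ A, |f A| ≤ C) {ε : ℝ}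
    (hε : 1 - ε ≤ ∏ x ∈ T, Real.cos (θ x - θ' x)) :
    |subsetExpectation θ T f - subsetExpectation θ' T f| ≤ C * √(8 * ε) := by
  set w := subsetAmplitude θ T
  set w' := subsetAmplitude θ' T
  have h1 : ∑ A ∈ T.powerset, w A ^ 2 = 1 := sum_subsetAmplitude_sq θ T
  have h2 : ∑ A ∈ T.powerset, w' A ^ 2 = 1 := sum_subsetAmplitude_sq θ' T
  have h3 : 1 - ε ≤ ∑ A ∈ T.powerset, w A * w' A := by
    rw [sum_subsetAmplitude_mul]
    exact hε
  have hminus : ∑ A ∈ T.powerset, |w A - w' A| ^ 2 ≤ 2 * ε := by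
    have : ∑ A ∈ T.powerset, |w A - w' A| ^ 2 = ∑ A ∈ T.powerset, w A ^ 2 +
        ∑ A ∈ T.powerset, w' A ^ 2 - 2 * ∑ A ∈ T.powerset, w A * w' A := by
      rw [Finset.mul_sum, ← Finset.sum_add_distrib, ← Finset.sum_sub_distrib]
      exact Finset.sum_congr rfl fun A _ => by rw [sq_abs]; ring
    rw [this, h1, h2]
    linarith
  have hplus : ∑ A ∈ T.powerset, |w A + w' A| ^ 2 ≤ 4 := by
    have : ∑ A ∈ T.powerset, |w A + w' A| ^ 2 ≤
        ∑ A ∈ T.powerset, (2 * w A ^ 2 + 2 * w' A ^ 2) :=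
      Finset.sum_le_sum fun A _ => by
        rw [sq_abs]
        linarith [sq_nonneg (w A - w' A)]
    rw [Finset.sum_add_distrib, ← Finset.mul_sum, ← Finset.mul_sum, h1, h2] at this
    linarith
  have hcs : ∑ A ∈ T.powerset, |w A - w' A| * |w A + w' A| ≤ √(8 * ε) := by
    apply Real.le_sqrt_of_sq_le
    refine (Finset.sum_mul_sq_le_sq_mul_sq _ _ _).trans ?_
    calc _ ≤ (2 * ε) * 4 := mul_le_mul hminus hplus
            (Finset.sum_nonneg fun _ _ => sq_nonneg _)
            ((Finset.sum_nonneg fun _ _ => sq_nonneg _).trans hminus)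
      _ = 8 * ε := by ring
  calc |subsetExpectation θ T f - subsetExpectation θ' T f|
      = |∑ A ∈ T.powerset, (w A - w' A) * (w A + w' A) * f A| := by
        rw [subsetExpectation, subsetExpectation, ← Finset.sum_sub_distrib]
        congr 1
        exact Finset.sum_congr rfl fun A _ => by ring
    _ ≤ ∑ A ∈ T.powerset, |(w A - w' A) * (w A + w' A) * f A| :=
        Finset.abs_sum_le_sum_abs _ _
    _ ≤ ∑ A ∈ T.powerset, C * (|w A - w' A| * |w A + w' A|) :=
        Finset.sum_le_sum fun A _ => by
          rw [abs_mul, abs_mul, mul_comm]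
          exact mul_le_mul_of_nonneg_right (hf A) (by positivity)
    _ ≤ C * √(8 * ε) := by
        rw [← Finset.mul_sum]
        exact mul_le_mul_of_nonneg_left hcs hC

/-- Points of angle zero are never chosen. This allows an angle function and its translate to be
compared on a common finite set. -/
theorem subsetExpectation_eq_of_subset {θ : X → ℝ} {T T' : Finset X} (hT : T ⊆ T')
    (hθ : ∀ x, x ∉ T → θ x = 0) (f : Finset X → ℝ) :
    subsetExpectation θ T' f = subsetExpectation θ T f := by
  symm
  refine (Finset.sum_congr rfl fun A hA => ?_).trans
    (Finset.sum_subset (Finset.powerset_mono.2 hT) fun A hA hA' => ?_)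
  · rw [Finset.mem_powerset] at hA
    congr 2
    rw [subsetAmplitude, subsetAmplitude]
    congr 1
    refine Finset.prod_subset (Finset.sdiff_subset_sdiff hT le_rfl) fun x hx hx' => ?_
    rw [hθ x, Real.cos_zero]
    intro hxT
    exact hx' (Finset.mem_sdiff.2 ⟨hxT, (Finset.mem_sdiff.1 hx).2⟩)
  · rw [Finset.mem_powerset, Finset.not_subset] at hA'
    obtain ⟨x, hx, hxT⟩ := hA'
    rw [subsetAmplitude, Finset.prod_eq_zero hx (by rw [hθ x hxT, Real.sin_zero])]
    ring

theorem subsetExpectation_map (θ : X → ℝ) (T : Finset X) (e : X ≃ X) (f : Finset X → ℝ) :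
    subsetExpectation θ T (fun A => f (A.map e.toEmbedding)) =
      subsetExpectation (fun x => θ (e.symm x)) (T.map e.toEmbedding) f := by
  rw [subsetExpectation, subsetExpectation]
  refine Finset.sum_bij (fun A _ => A.map e.toEmbedding) (fun A hA => ?_)
    (fun A _ B _ h => Finset.map_injective _ h) (fun B hB => ?_) fun A _ => ?_
  · rw [Finset.mem_powerset] at hA ⊢
    exact Finset.map_subset_map.2 hA
  · rw [Finset.mem_powerset] at hB
    refine ⟨B.map e.symm.toEmbedding, ?_, ?_⟩
    · rw [Finset.mem_powerset]
      intro x hx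
      rw [Finset.mem_map_equiv] at hx
      have := hB hx
      rw [Finset.mem_map_equiv] at this
      simpa using this
    · ext x
      simp
  · congr 2
    rw [subsetAmplitude, subsetAmplitude, Finset.prod_map, ← Finset.map_sdiff, Finset.prod_map]
    simp

theorem subsetExpectation_congr {θ : X → ℝ} {T : Finset X} {x : X} (hx : x ∈ T)
    (hθ : θ x = Real.pi / 2) {f f' : Finset X → ℝ} (h : ∀ A, x ∈ A → f A = f' A) :
    subsetExpectation θ T f = subsetExpectation θ T f' := by
  refine Finset.sum_congr rfl fun A _ => ?_
  by_cases hA : x ∈ A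
  · rw [h A hA]
  · rw [subsetAmplitude, Finset.prod_eq_zero (Finset.mem_sdiff.2 ⟨hx, hA⟩)
      (by rw [hθ, Real.cos_pi_div_two])]
    ring

/-- Only factors indexed by `S` can differ from one; combine `1 - t² / 2 ≤ cos t` with Bernoulli's
inequality. -/
theorem one_sub_le_prod_cos {T S : Finset X} {η : X → ℝ} {δ : ℝ} (hδ0 : 0 ≤ δ) (hδ : δ ≤ 1)
    (hS : ∀ x ∈ T, x ∉ S → η x = 0) (hη : ∀ x, |η x| ≤ δ) :
    1 - S.card * (δ ^ 2 / 2) ≤ ∏ x ∈ T, Real.cos (η x) := by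
  have h1 : ∏ x ∈ T ∩ S, Real.cos (η x) = ∏ x ∈ T, Real.cos (η x) := by
    refine Finset.prod_subset Finset.inter_subset_left fun x hx hx' => ?_
    rw [hS x hx fun h => hx' (Finset.mem_inter.2 ⟨hx, h⟩), Real.cos_zero]
  have hδ2 : δ ^ 2 ≤ 1 := by nlinarith
  rw [← h1]
  calc 1 - S.card * (δ ^ 2 / 2) ≤ 1 + (T ∩ S).card * (-(δ ^ 2 / 2)) := by
        have : ((T ∩ S).card : ℝ) ≤ S.card := by
          exact_mod_cast Finset.card_le_card Finset.inter_subset_right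
        nlinarith [sq_nonneg δ]
    _ ≤ (1 + -(δ ^ 2 / 2)) ^ (T ∩ S).card := one_add_mul_le_pow (by linarith) _
    _ = ∏ x ∈ T ∩ S, (1 + -(δ ^ 2 / 2)) := by rw [Finset.prod_const]
    _ ≤ ∏ x ∈ T ∩ S, Real.cos (η x) := by
        refine Finset.prod_le_prod (fun _ _ => by linarith) fun x _ => ?_
        have := Real.one_sub_sq_div_two_le_cos (x := η x)
        have h2 : η x ^ 2 ≤ δ ^ 2 := sq_le_sq' (abs_le.1 (hη x)).1 (abs_le.1 (hη x)).2
        linarith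

end RandomSubset

/-! ### Small capacity and extensive amenability -/

section ExtensiveAmenability

variable (G X : Type*) [Group G] [MulAction G X]

/-- For every finite part of the graph of the action there are integer-valued functions of finite
support, constant and large on a given finite set, of linearly bounded energy. -/
def HasSmallCapacity : Prop :=
  ∀ (S : Finset G) (F : Finset X), ∃ B : ℕ, ∀ k : ℕ, 0 < k → ∃ r : X → ℕ,
    (∀ x, r x ≤ k) ∧ {x | r x ≠ 0}.Finite ∧ (∀ x ∈ F, r x = k) ∧
    ∀ g ∈ S, (∀ x, r x ≤ r (g • x) + 1 ∧ r (g • x) ≤ r x + 1) ∧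
      ∃ D : Finset X, D.card ≤ B * k ∧ ∀ x, x ∉ D → r (g • x) = r x

variable {G X}

open Classical in
/-- An action has small capacity if the finite parts of its graph are exhausted by finite sets
with a bounded number of boundary edges. -/
theorem HasSmallCapacity.of_exhaustion (h : ∀ (S : Finset G) (F : Finset X),
    ∃ (T : ℕ → Set X) (B : ℕ), Monotone T ∧ (∀ n, (T n).Finite) ∧ (∃ n, ↑F ⊆ T n) ∧
      ∀ g ∈ S, (∀ n, ∀ u ∈ T n, ∃ m, g • u ∈ T m) ∧ (∀ n u, g • u ∈ T n → ∃ m, u ∈ T m) ∧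
        ∀ n, ∃ L : Finset X, L.card ≤ B ∧ ∀ u, u ∉ L → (u ∈ T n ↔ g • u ∈ T n)) :
    HasSmallCapacity G X := by
  intro S F
  obtain ⟨T, B, hT, hfin, ⟨n₀, hn₀⟩, hS⟩ := h S F
  have hbound : ∀ (A : Set X), A.Finite → (∀ u ∈ A, ∃ m, u ∈ T m) → ∃ m, A ⊆ T m := by
    intro A hA h
    choose! m hm using h
    obtain ⟨N, hN⟩ := (hA.image m).bddAbove
    exact ⟨N, fun u hu => hT (hN ⟨u, hu, rfl⟩) (hm u hu)⟩
  have hnext : ∀ n, ∃ n', n ≤ n' ∧ ∀ g ∈ S, ∀ u, (u ∈ T n → g • u ∈ T n') ∧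
      (g • u ∈ T n → u ∈ T n') := by
    intro n
    obtain ⟨m, hm⟩ := hbound (⋃ g ∈ S, ((g • ·) '' T n ∪ (g • ·) ⁻¹' T n))
      (S.finite_toSet.biUnion fun g _ => ((hfin n).image _).union
        ((hfin n).preimage (MulAction.injective g).injOn)) (by
        intro u hu
        obtain ⟨g, hg, hu⟩ := Set.mem_iUnion₂.1 hu
        rcases hu with ⟨v, hv, rfl⟩ | hu
        · exact (hS g hg).1 n v hv
        · exact (hS g hg).2.1 n u hu)
    refine ⟨max n m, le_max_left _ _, fun g hg u => ⟨fun hu => ?_, fun hu => ?_⟩⟩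
    · exact hT (le_max_right _ _) (hm (Set.mem_biUnion hg (Or.inl ⟨u, hu, rfl⟩)))
    · exact hT (le_max_right _ _) (hm (Set.mem_biUnion hg (Or.inr hu)))
  choose next hle hnext using hnext
  -- A subsequence sparse enough that each `g ∈ S`, as well as its inverse, moves one set into the
  -- next.
  set a : ℕ → ℕ := fun i => next^[i] n₀ with ha
  have ha1 : ∀ i, a (i + 1) = next (a i) := fun i => Function.iterate_succ_apply' _ _ _
  have hmono : Monotone a := monotone_nat_of_le_succ fun i => by rw [ha1]; exact hle _
  -- Shifting indices by one can push only the last index out of `range k`; this is the extra one in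
  -- the bound.
  have hcard : ∀ (k : ℕ) (P Q : ℕ → Prop), (∀ i, P i → Q (i + 1)) →
      ((Finset.range k).filter P).card ≤ ((Finset.range k).filter Q).card + 1 := by
    intro k P Q hPQ
    rw [← Finset.card_image_of_injective _ Nat.succ_injective]
    refine (Finset.card_le_card ?_).trans (Finset.card_insert_le k _)
    intro j hj
    obtain ⟨i, hi, rfl⟩ := Finset.mem_image.1 hj
    rw [Finset.mem_filter, Finset.mem_range] at hi
    rw [Finset.mem_insert, Finset.mem_filter, Finset.mem_range]
    have := hPQ i hi.2
    by_cases hik : i + 1 = k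
    · exact Or.inl hik
    · exact Or.inr ⟨by omega, this⟩
  -- The function counts which of `k` nested sets contain the point. It can change under `g` only on
  -- the exceptional sets of these `k` sets, at most `B` points each.
  refine ⟨B, fun k _ => ⟨fun u => ((Finset.range k).filter fun i => u ∈ T (a i)).card,
    fun u => ?_, ?_, fun u hu => ?_, fun g hg => ⟨fun u => ⟨?_, ?_⟩, ?_⟩⟩⟩
  · exact (Finset.card_filter_le _ _).trans_eq (Finset.card_range k)
  · refine (hfin (a k)).subset fun u hu => ?_
    obtain ⟨i, hi⟩ := Finset.card_ne_zero.1 hu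
    rw [Finset.mem_filter, Finset.mem_range] at hi
    exact hT (hmono hi.1.le) hi.2
  · beta_reduce
    rw [Finset.filter_true_of_mem, Finset.card_range]
    exact fun i _ => hT (hmono (Nat.zero_le i)) (hn₀ hu)
  · exact hcard k _ _ fun i hi => by rw [ha1]; exact (hnext _ g hg u).1 hi
  · exact hcard k _ _ fun i hi => by rw [ha1]; exact (hnext _ g hg u).2 hi
  · choose L hL hLS using (hS g hg).2.2
    refine ⟨(Finset.range k).biUnion fun i => L (a i), ?_, fun x hx => ?_⟩
    · refine (Finset.card_biUnion_le_card_mul _ _ B fun i _ => hL _).trans_eq ?_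
      rw [Finset.card_range, mul_comm]
    · refine congrArg Finset.card (Finset.filter_congr fun i hi =>
        (hLS _ x fun h => hx ?_).symm)
      exact Finset.mem_biUnion.2 ⟨i, hi, h⟩

open Classical in
-- Take the random subset with angles `(π / 2) (r x / k)`. Points of `F` have angle `π / 2` and are
-- always chosen. Under `g ∈ S` at most `B k` angles change, each by at most `π / (2 k)`, so the
-- defect of the affinity is of order `1 / k`.
theorem HasSmallCapacity.exists_almost_invariant (h : HasSmallCapacity G X) (S : Finset G)
    (F : Finset X) {ε : ℝ} (hε : 0 < ε) : ∃ p : (Finset X → ℝ) → ℝ, IsMean p ∧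
      (∀ x ∈ F, ∀ f f', (∀ A, x ∈ A → f A = f' A) → p f = p f') ∧
      ∀ g ∈ S, ∀ f C, 0 ≤ C → (∀ A, |f A| ≤ C) →
        |p (fun A => f (A.map (MulAction.toPerm g).toEmbedding)) - p f| ≤ C * ε := by
  obtain ⟨B, hB⟩ := h S F
  -- The first bound gives `δ ≤ 1`; the second is exactly what makes `8 (B k) (δ² / 2) = B π² / k`
  -- at most `ε²`.
  obtain ⟨k, hk⟩ := exists_nat_gt (max 2 (B * Real.pi ^ 2 / ε ^ 2))
  have hk2 : (2 : ℝ) < k := (le_max_left _ _).trans_lt hk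
  have hkB : B * Real.pi ^ 2 / ε ^ 2 < k := (le_max_right _ _).trans_lt hk
  have hk0 : (0 : ℝ) < k := by linarith
  obtain ⟨r, hrk, hfin, hrF, hr⟩ := hB k (by exact_mod_cast hk0)
  set T : Finset X := hfin.toFinset ∪ F with hT
  set δ : ℝ := Real.pi / 2 / k with hδ
  have hδ0 : 0 < δ := by positivity
  have hδ1 : δ ≤ 1 := by
    rw [hδ, div_le_one hk0]
    linarith [Real.pi_le_four]
  set θ : X → ℝ := fun x => δ * r x with hθ
  have hθT : ∀ x, x ∉ T → θ x = 0 := by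
    intro x hx
    have : r x = 0 := by
      by_contra h
      exact hx (Finset.mem_union_left _ (hfin.mem_toFinset.2 h))
    simp [hθ, this]
  refine ⟨subsetExpectation θ T, isMean_subsetExpectation θ T, ?_, ?_⟩
  · intro x hx f f' hff'
    refine subsetExpectation_congr (Finset.mem_union_right _ hx) ?_ hff'
    simp only [hθ, hrF x hx, hδ]
    field_simp
  · intro g hg f C hC hf
    obtain ⟨h1, D, hD, hDr⟩ := hr g hg
    set e : X ≃ X := MulAction.toPerm g with he
    rw [subsetExpectation_map]
    set T' := T ∪ T.map e.toEmbedding with hT'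
    rw [← subsetExpectation_eq_of_subset (T' := T') Finset.subset_union_left hθT,
      ← subsetExpectation_eq_of_subset (T' := T') Finset.subset_union_right (fun x hx =>
        hθT _ fun h => hx (Finset.mem_map_equiv.2 h))]
    refine (abs_subsetExpectation_sub_le (ε := (B * k : ℕ) * (δ ^ 2 / 2)) _ _ _ hC hf ?_).trans ?_
    · refine le_trans ?_ (one_sub_le_prod_cos (S := D.map e.toEmbedding) hδ0.le hδ1 ?_ ?_)
      · rw [Finset.card_map]
        have : (D.card : ℝ) ≤ (B * k : ℕ) := by exact_mod_cast hD
        nlinarith [sq_nonneg δ]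
      · intro x _ hx
        have hx' : e.symm x ∉ D := fun h => hx (Finset.mem_map_equiv.2 h)
        have := hDr _ hx'
        rw [show g • e.symm x = x from e.apply_symm_apply x] at this
        simp only [hθ, this, sub_self]
      · intro x
        have := h1 (e.symm x)
        rw [show g • e.symm x = x from e.apply_symm_apply x] at this
        have h2 : (r (e.symm x) : ℝ) ≤ r x + 1 := by exact_mod_cast this.1
        have h3 : (r x : ℝ) ≤ r (e.symm x) + 1 := by exact_mod_cast this.2
        simp only [hθ]
        rw [← mul_sub, abs_mul, abs_of_pos hδ0]
        refine mul_le_of_le_one_right hδ0.le ?_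
        rw [abs_le]
        constructor <;> linarith
    · refine mul_le_mul_of_nonneg_left ?_ hC
      rw [Real.sqrt_le_left hε.le, hδ]
      rw [div_lt_iff₀ (by positivity)] at hkB
      have : 8 * (((B * k : ℕ) : ℝ) * ((Real.pi / 2 / k) ^ 2 / 2)) = B * Real.pi ^ 2 / k := by
        push_cast
        field_simp
        ring
      rw [this, div_le_iff₀ hk0]
      linarith

/-- An action of small capacity is extensively amenable. -/
theorem HasSmallCapacity.exists_invariant_mean (h : HasSmallCapacity G X) :
    ∃ m : (Finset X → ℝ) → ℝ, IsMean m ∧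
      (∀ Z f f', BoundedFun f → BoundedFun f' → (∀ A, Z ⊆ A → f A = f' A) → m f = m f') ∧
      ∀ (g : G) f, BoundedFun f →
        m (fun A => f (A.map (MulAction.toPerm g).toEmbedding)) = m f := by
  classical
  have hex := fun i : Finset G × Finset X × ℕ =>
    h.exists_almost_invariant i.1 i.2.1 (ε := ((i.2.2 : ℝ) + 1)⁻¹) (by positivity)
  choose p hp hpF hpS using hex
  obtain ⟨m, hm, hm'⟩ := exists_isMean_of_tendsto atTop hp
  have hone : ∀ x f f', BoundedFun f → BoundedFun f' → (∀ A, x ∈ A → f A = f' A) →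
      m f = m f' := by
    intro x f f' hf hf' hff'
    refine hm' _ _ hf hf' (tendsto_const_nhds.congr' ?_)
    filter_upwards [eventually_ge_atTop ((∅, {x}, 0) : Finset G × Finset X × ℕ)] with i hi
    rw [eq_comm, sub_eq_zero]
    exact hpF i x (hi.2.1 (Finset.mem_singleton_self x)) f f' hff'
  refine ⟨m, hm, fun Z => ?_, fun g f hf => hm' _ _ (hf.comp _) hf ?_⟩
  · induction Z using Finset.induction_on with
    | empty =>
      intro f f' _ _ hff'
      rw [show f = f' from funext fun A => hff' A (Finset.empty_subset A)]
    | insert x Z _ ih =>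
      intro f f' hf hf' hff'
      have hb : BoundedFun fun A : Finset X => if x ∈ A then f A else f' A := by
        obtain ⟨C, hC⟩ := hf
        obtain ⟨C', hC'⟩ := hf'
        refine ⟨max C C', fun A => ?_⟩
        beta_reduce
        split_ifs
        · exact (hC A).trans (le_max_left _ _)
        · exact (hC' A).trans (le_max_right _ _)
      rw [hone x f _ hf hb fun A hA => (if_pos hA).symm]
      refine ih _ _ hb hf' fun A hA => ?_
      split_ifs with h
      · exact hff' A (Finset.insert_subset h hA)
      · rfl
  · obtain ⟨C, hC⟩ := hf
    have hC0 : 0 ≤ C := (abs_nonneg _).trans (hC ∅)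
    have hlim : Tendsto (fun i : Finset G × Finset X × ℕ => C * ((i.2.2 : ℝ) + 1)⁻¹) atTop
        (𝓝 0) := by
      have h1 : Tendsto (fun n : ℕ => C * ((n : ℝ) + 1)⁻¹) atTop (𝓝 (C * 0)) := by
        refine Tendsto.const_mul C ?_
        simpa [Function.comp_def] using
          (tendsto_inv_atTop_nhds_zero_nat (𝕜 := ℝ)).comp (tendsto_add_atTop_nat 1)
      rw [mul_zero] at h1
      have h2 : Tendsto (fun i : Finset G × Finset X × ℕ => i.2.2) atTop atTop := by
        rw [← prod_atTop_atTop_eq, ← prod_atTop_atTop_eq]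
        exact tendsto_snd.comp tendsto_snd
      exact h1.comp h2
    refine squeeze_zero_norm' ?_ hlim
    filter_upwards [eventually_ge_atTop (({g}, ∅, 0) : Finset G × Finset X × ℕ)] with i hi
    exact hpS i g (hi.1 (Finset.mem_singleton_self g)) f C hC0 hC

end ExtensiveAmenability

namespace RootedTree

universe u

variable {E : ℕ → Type u}

namespace Boundary

/-! ## Beginnings and tails of infinite words -/

/-- Two infinite words have the same beginning of length `n`. -/
def Agree (n : ℕ) (ξ η : Boundary E) : Prop := ξ.beginning n = η.beginning n

/-- Two infinite words differ only in the first `n` letters. -/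
def TailEq (n : ℕ) (ξ η : Boundary E) : Prop := ∀ i, n ≤ i → ξ i = η i

theorem agree_iff {n : ℕ} {ξ η : Boundary E} : Agree n ξ η ↔ ∀ i < n, ξ i = η i :=
  ⟨fun h i hi => congrFun h ⟨i, hi⟩, fun h => funext fun i => h i i.2⟩

namespace Agree

variable {n m : ℕ} {ξ η ζ : Boundary E}

theorem refl (n : ℕ) (ξ : Boundary E) : Agree n ξ ξ := rfl

theorem symm (h : Agree n ξ η) : Agree n η ξ := Eq.symm h

theorem trans (h : Agree n ξ η) (h' : Agree n η ζ) : Agree n ξ ζ := Eq.trans h h'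

theorem mono (hmn : m ≤ n) (h : Agree n ξ η) : Agree m ξ η :=
  agree_iff.2 fun i hi => agree_iff.1 h i (hi.trans_le hmn)

theorem smul (g : TreeAut E) (h : Agree n ξ η) : Agree n (g • ξ) (g • η) := by
  rw [Agree, beginning_smul, beginning_smul]
  exact congrArg _ h

end Agree

namespace TailEq

variable {n m : ℕ} {ξ η ζ : Boundary E}

theorem refl (n : ℕ) (ξ : Boundary E) : TailEq n ξ ξ := fun _ _ => rfl

theorem symm (h : TailEq n ξ η) : TailEq n η ξ := fun i hi => (h i hi).symm

theorem trans (h : TailEq n ξ η) (h' : TailEq n η ζ) : TailEq n ξ ζ :=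
  fun i hi => (h i hi).trans (h' i hi)

theorem mono (hmn : m ≤ n) (h : TailEq m ξ η) : TailEq n ξ η :=
  fun i hi => h i (hmn.trans hi)

theorem eq_of_agree (h : TailEq n ξ η) (h' : Agree n ξ η) : ξ = η :=
  funext fun i => (lt_or_ge i n).elim (agree_iff.1 h' i) (h i)

end TailEq

theorem exists_not_agree {ξ η : Boundary E} (h : ξ ≠ η) : ∃ n, ¬ Agree n ξ η := by
  by_contra! h'
  exact h (beginning_injective h')

/-- Long enough beginnings separate finitely many infinite words. -/
theorem exists_injOn_beginning (A : Finset (Boundary E)) :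
    ∃ n, ∀ ξ ∈ A, ∀ η ∈ A, Agree n ξ η → ξ = η := by
  have h : ∀ p : Boundary E × Boundary E, ∃ n, Agree n p.1 p.2 → p.1 = p.2 := by
    intro p
    by_cases hp : p.1 = p.2
    · exact ⟨0, fun _ => hp⟩
    · exact (exists_not_agree hp).imp fun n hn h => absurd h hn
  choose n hn using h
  refine ⟨(A ×ˢ A).sup n, fun ξ hξ η hη h => hn (ξ, η) (h.mono ?_)⟩
  exact Finset.le_sup (f := n) (Finset.mk_mem_product hξ hη)

theorem eventually_nhds_iff {ξ : Boundary E} {P : Boundary E → Prop} :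
    (∀ᶠ η in 𝓝 ξ, P η) ↔ ∃ n, ∀ η, Agree n η ξ → P η := by
  let _ : ∀ i, TopologicalSpace (E i) := fun _ => ⊥
  have _ : ∀ i, DiscreteTopology (E i) := fun _ => ⟨rfl⟩
  constructor
  · intro h
    obtain ⟨U, hU, hUo, hξ⟩ := _root_.eventually_nhds_iff.1 h
    obtain ⟨I, u, hu, hIu⟩ := isOpen_pi_iff.1 hUo ξ hξ
    refine ⟨I.sup id + 1, fun η hη => hU η (hIu fun i hi => ?_)⟩
    rw [agree_iff.1 hη i (Nat.lt_succ_of_le (Finset.le_sup (f := id) hi))]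
    exact (hu i hi).2
  · rintro ⟨n, hn⟩
    have h1 : Continuous fun η : Boundary E => η.beginning n :=
      continuous_pi fun i => continuous_apply (A := E) (i : ℕ)
    have h2 : {ξ.beginning n} ∈ 𝓝 (ξ.beginning n) := by
      rw [nhds_discrete]
      exact rfl
    filter_upwards [h1.continuousAt h2] with η hη
    exact hn η hη

/-- A property of long enough beginnings that holds locally holds uniformly. -/
theorem exists_uniform [∀ i, Finite (E i)] {P : ℕ → Boundary E → Prop}
    (hmono : ∀ m n ξ, m ≤ n → P m ξ → P n ξ)
    (h : ∀ ξ, ∃ n, ∀ η, Agree n η ξ → P n η) : ∃ n, ∀ ξ, P n ξ := by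
  let _ : ∀ i, TopologicalSpace (E i) := fun _ => ⊥
  have _ : ∀ i, DiscreteTopology (E i) := fun _ => ⟨rfl⟩
  have : CompactSpace (Boundary E) := inferInstanceAs (CompactSpace (∀ i, E i))
  choose n hn using h
  obtain ⟨t, -, ht⟩ := isCompact_univ.elim_nhds_subcover
    (fun ξ : Boundary E => {η | Agree (n ξ) η ξ})
    fun ξ _ => eventually_nhds_iff.2 ⟨n ξ, fun _ h => h⟩
  refine ⟨t.sup n, fun ξ => ?_⟩
  obtain ⟨η, hη, hξ⟩ := Set.mem_iUnion₂.1 (ht (Set.mem_univ ξ))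
  exact hmono _ _ _ (Finset.le_sup hη) (hn η ξ hξ)

theorem exists_beginning_eq [∀ i, Nonempty (E i)] {n : ℕ} (v : Word E n) :
    ∃ ξ : Boundary E, ξ.beginning n = v := by
  classical
  refine ⟨fun i => if h : i < n then v ⟨i, h⟩ else Classical.arbitrary _, ?_⟩
  funext i
  exact dif_pos i.2

theorem eq_of_forall_smul_eq [∀ i, Nonempty (E i)] {g h : TreeAut E}
    (hgh : ∀ ξ : Boundary E, g • ξ = h • ξ) : g = h := by
  refine Subtype.ext (RelIso.ext ?_)
  rintro ⟨n, v⟩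
  obtain ⟨ξ, rfl⟩ := exists_beginning_eq v
  rw [TreeAut.apply_mk, TreeAut.apply_mk, ← beginning_smul, ← beginning_smul, hgh]

/-! ## Bounded automorphisms -/

/-- The beginnings of length `n` of the infinite words with a letter after the first `n` changed
by `g`. -/
def activeWords (g : TreeAut E) (n : ℕ) : Set (Word E n) :=
  {v | ∃ ξ : Boundary E, ξ.beginning n = v ∧ ¬ TailEq n (g • ξ) ξ}

theorem tailEq_smul_of_sectionAt_eq_one {g : TreeAut E} {n : ℕ} {ξ : Boundary E}
    (h : g.sectionAt (ξ.beginning n) = 1) : TailEq n (g • ξ) ξ := by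
  intro i hi
  obtain ⟨j, rfl⟩ := Nat.exists_eq_add_of_le hi
  have hξ : ξ.beginning (n + (j + 1)) =
      (ξ.beginning n).append ((ξ.beginning (n + (j + 1))).drop n) :=
    (Word.append_take_drop (ξ.beginning (n + (j + 1)))).symm
  have h1 := beginning_smul g ξ (n + (j + 1))
  rw [hξ, TreeAut.onLevel_append, h, TreeAut.onLevel_one] at h1
  have h2 := congrArg (Word.drop n) h1
  rw [Word.drop_append] at h2
  exact congrFun h2 (Fin.last j)

theorem encard_activeWords_le (g : TreeAut E) (n : ℕ) :
    (activeWords g n).encard ≤ g.activity n := by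
  refine Set.encard_le_encard ?_
  rintro _ ⟨ξ, rfl, hξ⟩
  exact fun h => hξ (tailEq_smul_of_sectionAt_eq_one h)

/-- The infinite words in no neighbourhood of which `g` is finitary. -/
def singularSet (g : TreeAut E) : Set (Boundary E) :=
  {ξ | ∀ n, ξ.beginning n ∈ activeWords g n}

theorem exists_tailEq_of_notMem_singularSet {g : TreeAut E} {ξ : Boundary E}
    (h : ξ ∉ singularSet g) : ∃ n, ∀ η, Agree n η ξ → TailEq n (g • η) η := by
  simp only [singularSet, Set.mem_ofPred_eq, not_forall] at h
  obtain ⟨n, hn⟩ := h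
  refine ⟨n, fun η hη => ?_⟩
  by_contra h
  exact hn ⟨η, hη, h⟩

theorem encard_le_of_injOn_beginning {n : ℕ} {C : ℕ} {g : TreeAut E}
    (hC : (activeWords g n).encard ≤ C) {A : Set (Boundary E)}
    (hA : ∀ ξ ∈ A, ξ.beginning n ∈ activeWords g n)
    (hinj : Set.InjOn (fun ξ : Boundary E => ξ.beginning n) A) : A.encard ≤ C := by
  rw [← hinj.encard_image]
  refine (Set.encard_le_encard ?_).trans hC
  rintro _ ⟨ξ, hξ, rfl⟩
  exact hA ξ hξ

/-- On a level that separates them, `C + 1` singular points would give `C + 1` active words. -/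
theorem finite_singularSet {g : TreeAut E} (hg : g.IsBounded) : (singularSet g).Finite := by
  obtain ⟨C, hC⟩ := hg
  by_contra hinf
  obtain ⟨A, hA, hcard⟩ := Set.Infinite.exists_subset_card_eq hinf (C + 1)
  obtain ⟨n, hn⟩ := exists_injOn_beginning A
  have := encard_le_of_injOn_beginning ((encard_activeWords_le g n).trans (hC n))
    (A := (A : Set (Boundary E))) (fun ξ hξ => hA hξ n) fun ξ hξ η hη h => hn ξ hξ η hη h
  rw [Set.encard_coe_eq_coe_finsetCard, hcard] at this
  have h' : C + 1 ≤ C := by exact_mod_cast this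
  omega

/-! ### Exhaustion by tails and small capacity of the boundary action -/

/-- The infinite words that differ from one of the given ones only in the first `n` letters. -/
def tailSet (Z : Finset (Boundary E)) (n : ℕ) : Set (Boundary E) :=
  {ξ | ∃ ζ ∈ Z, TailEq n ξ ζ}

theorem monotone_tailSet (Z : Finset (Boundary E)) : Monotone (tailSet Z) :=
  fun _ _ hmn _ ⟨ζ, hζ, h⟩ => ⟨ζ, hζ, h.mono hmn⟩

theorem finite_tailSet [∀ i, Finite (E i)] (Z : Finset (Boundary E)) (n : ℕ) :
    (tailSet Z n).Finite := by
  have : tailSet Z n = ⋃ ζ ∈ Z, {ξ | TailEq n ξ ζ} := by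
    ext ξ
    simp [tailSet]
  rw [this]
  refine Z.finite_toSet.biUnion fun ζ _ => Set.Finite.of_finite_image
    (f := fun ξ : Boundary E => ξ.beginning n) (Set.toFinite _) ?_
  intro ξ hξ η hη h
  exact (TailEq.trans hξ (TailEq.symm hη)).eq_of_agree h

open Classical in
-- A point can leave only if `g` changes its tail, so its beginning is active. Within one tail class
-- the beginning determines the point, so each `ζ ∈ Z` accounts for at most `C` points,
-- independently of `n`.
theorem exists_boundary_tailSet {g : TreeAut E} {C : ℕ} (hC : ∀ n, g.activity n ≤ C)
    (Z : Finset (Boundary E)) (n : ℕ) : ∃ L : Finset (Boundary E), L.card ≤ Z.card * C ∧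
      ∀ ξ, ξ ∉ L → ξ ∈ tailSet Z n → g • ξ ∈ tailSet Z n := by
  have h : ∀ ζ : Boundary E,
      {ξ : Boundary E | TailEq n ξ ζ ∧ ¬ TailEq n (g • ξ) ξ}.encard ≤ C := by
    intro ζ
    refine encard_le_of_injOn_beginning ((encard_activeWords_le g n).trans (hC n))
      (fun ξ hξ => ⟨ξ, rfl, hξ.2⟩) fun ξ hξ η hη h => ?_
    exact (hξ.1.trans hη.1.symm).eq_of_agree h
  have hfin : ∀ ζ : Boundary E,
      {ξ : Boundary E | TailEq n ξ ζ ∧ ¬ TailEq n (g • ξ) ξ}.Finite := fun ζ =>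
    Set.finite_of_encard_le_coe (h ζ)
  refine ⟨Z.biUnion fun ζ => (hfin ζ).toFinset, ?_, ?_⟩
  · refine Finset.card_biUnion_le_card_mul _ _ _ fun ζ _ => ?_
    have := h ζ
    rw [(hfin ζ).encard_eq_coe_toFinset_card] at this
    exact_mod_cast this
  · rintro ξ hξ ⟨ζ, hζ, hξζ⟩
    refine ⟨ζ, hζ, TailEq.trans ?_ hξζ⟩
    by_contra h'
    exact hξ (Finset.mem_biUnion.2 ⟨ζ, hζ, (hfin ζ).mem_toFinset.2 ⟨hξζ, h'⟩⟩)

theorem exists_smul_mem_tailSet {g : TreeAut E} {Z : Finset (Boundary E)}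
    (hZ : ∀ ξ ∈ singularSet g, g • ξ ∈ Z) {n : ℕ} {ξ : Boundary E} (hξ : ξ ∈ tailSet Z n) :
    ∃ m, g • ξ ∈ tailSet Z m := by
  by_cases hs : ξ ∈ singularSet g
  · exact ⟨0, g • ξ, hZ ξ hs, TailEq.refl _ _⟩
  · obtain ⟨m, hm⟩ := exists_tailEq_of_notMem_singularSet hs
    obtain ⟨ζ, hζ, h⟩ := hξ
    exact ⟨max n m, ζ, hζ, ((hm ξ rfl).mono (le_max_right _ _)).trans (h.mono (le_max_left _ _))⟩

open Classical in
-- Exhaust by the sets `tailSet Z n`. Away from singular points the elements of `S` preserve tails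
-- eventually; the images of the singular points are put into `Z`, so the union of the exhaustion is
-- closed under `S` and its inverses.
theorem hasSmallCapacity [∀ i, Finite (E i)] {G : Subgroup (TreeAut E)}
    (hG : ∀ g ∈ G, TreeAut.IsBounded g) : HasSmallCapacity G (Boundary E) := by
  refine HasSmallCapacity.of_exhaustion fun S F => ?_
  have hb : ∀ g : G, ∃ C : ℕ, ∀ n, (g : TreeAut E).activity n ≤ C := fun g => hG g g.2
  choose C hC using hb
  have hfin : ∀ g : G, (singularSet (g : TreeAut E)).Finite :=
    fun g => finite_singularSet (hG g g.2)
  set Z : Finset (Boundary E) := F ∪ S.biUnion fun g =>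
    ((hfin g).toFinset.image fun ξ => g • ξ) ∪ ((hfin g⁻¹).toFinset.image fun ξ => g⁻¹ • ξ) with hZ
  have hZ1 : ∀ g ∈ S, ∀ ξ ∈ singularSet (g : TreeAut E), (g : TreeAut E) • ξ ∈ Z :=
    fun g hg ξ hξ => Finset.mem_union_right _ (Finset.mem_biUnion.2 ⟨g, hg,
      Finset.mem_union_left _ (Finset.mem_image.2 ⟨ξ, (hfin g).mem_toFinset.2 hξ, rfl⟩)⟩)
  have hZ2 : ∀ g ∈ S, ∀ ξ ∈ singularSet ((g⁻¹ : G) : TreeAut E),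
      ((g⁻¹ : G) : TreeAut E) • ξ ∈ Z :=
    fun g hg ξ hξ => Finset.mem_union_right _ (Finset.mem_biUnion.2 ⟨g, hg,
      Finset.mem_union_right _ (Finset.mem_image.2 ⟨ξ, (hfin g⁻¹).mem_toFinset.2 hξ, rfl⟩)⟩)
  refine ⟨tailSet Z, ∑ g ∈ S, Z.card * (C g + C g⁻¹), monotone_tailSet Z, finite_tailSet Z,
    ⟨0, fun ξ hξ => ⟨ξ, Finset.mem_union_left _ hξ, TailEq.refl _ _⟩⟩, fun g hg =>
    ⟨fun n ξ hξ => exists_smul_mem_tailSet (hZ1 g hg) hξ, fun n ξ hξ => ?_, fun n => ?_⟩⟩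
  · obtain ⟨m, hm⟩ := exists_smul_mem_tailSet (hZ2 g hg) hξ
    exact ⟨m, by rwa [← inv_smul_smul g ξ]⟩
  · obtain ⟨L, hL, hL'⟩ := exists_boundary_tailSet (hC g) Z n
    obtain ⟨M, hM, hM'⟩ := exists_boundary_tailSet (hC g⁻¹) Z n
    refine ⟨L ∪ M.image fun ξ => g⁻¹ • ξ, ?_, fun ξ hξ => ⟨fun h => ?_, fun h => ?_⟩⟩
    · refine le_trans ?_ (Finset.single_le_sum
        (f := fun g => Z.card * (C g + C g⁻¹)) (fun _ _ => Nat.zero_le _) hg)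
      rw [mul_add]
      exact (Finset.card_union_le _ _).trans
        (add_le_add hL (Finset.card_image_le.trans hM))
    · exact hL' ξ (fun h' => hξ (Finset.mem_union_left _ h')) h
    · have := hM' (g • ξ) (fun h' => hξ (Finset.mem_union_right _
        (Finset.mem_image.2 ⟨_, h', inv_smul_smul g ξ⟩))) h
      rwa [← inv_smul_smul g ξ]

end Boundary

end RootedTree

namespace RootedTree

universe u

variable {E : ℕ → Type u}

open Boundary

/-! ## Germs up to finitary germs -/

/-- Two automorphisms differ near `ξ` only in finitely many letters. -/
def TailRel (ξ : Boundary E) (g h : TreeAut E) : Prop :=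
  ∃ n, ∀ η, Agree n η ξ → TailEq n (g • η) (h • η)

namespace TailRel

variable {ξ : Boundary E} {f g h : TreeAut E}

theorem refl (ξ : Boundary E) (g : TreeAut E) : TailRel ξ g g := ⟨0, fun _ _ => TailEq.refl _ _⟩

theorem symm (H : TailRel ξ g h) : TailRel ξ h g :=
  H.imp fun _ hn η hη => (hn η hη).symm

theorem trans (H : TailRel ξ f g) (H' : TailRel ξ g h) : TailRel ξ f h := by
  obtain ⟨m, hm⟩ := H
  obtain ⟨n, hn⟩ := H'
  refine ⟨max m n, fun η hη => TailEq.trans (η := g • η) ?_ ?_⟩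
  · exact (hm η (hη.mono (le_max_left _ _))).mono (le_max_left _ _)
  · exact (hn η (hη.mono (le_max_right _ _))).mono (le_max_right _ _)

theorem mul_right (H : TailRel (f • ξ) g h) : TailRel ξ (g * f) (h * f) := by
  obtain ⟨n, hn⟩ := H
  refine ⟨n, fun η hη => ?_⟩
  rw [mul_smul, mul_smul]
  exact hn _ (hη.smul f)

theorem smul_iff : TailRel (f • ξ) g h ↔ TailRel ξ (g * f) (h * f) := by
  refine ⟨mul_right, fun H => ?_⟩
  have H' : TailRel (f⁻¹ • f • ξ) (g * f) (h * f) := by rwa [inv_smul_smul]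
  simpa only [mul_inv_cancel_right] using H'.mul_right

theorem of_notMem_singularSet (H : ξ ∉ singularSet g) : TailRel ξ g 1 := by
  obtain ⟨n, hn⟩ := exists_tailEq_of_notMem_singularSet H
  exact ⟨n, fun η hη => by rw [one_smul]; exact hn η hη⟩

end TailRel

/-- A group of automorphisms which becomes locally finitary after composing with a locally
constant choice of automorphisms is amenable. -/
theorem isAmenableGroup_of_tailRel [∀ i, Finite (E i)] [∀ i, Nonempty (E i)]
    {G : Subgroup (TreeAut E)} (K : Subgroup G) {n : ℕ} (c : Word E n → TreeAut E)
    (h : ∀ k ∈ K, ∀ ξ : Boundary E,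
      TailRel ξ (c ((k • ξ).beginning n) * k) (c (ξ.beginning n))) :
    IsAmenableGroup K := by
  set f : Boundary E → Boundary E := fun ξ => c (ξ.beginning n) • ξ with hf
  set L : ℕ → Subgroup K := fun N =>
    { carrier := {k | ∀ ξ, TailEq (n + N) (f (k • ξ)) (f ξ)}
      one_mem' := fun ξ => by rw [one_smul]; exact TailEq.refl _ _
      mul_mem' := fun {a b} ha hb ξ => by
        rw [mul_smul]
        exact (ha (b • ξ)).trans (hb ξ)
      inv_mem' := fun {a} ha ξ => by
        have := ha (a⁻¹ • ξ)
        rw [smul_inv_smul] at this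
        exact this.symm } with hL
  refine isAmenableGroup_of_monotone_finite L (fun M N hMN k hk ξ => ?_) (fun N => ?_) fun k => ?_
  · exact (hk ξ).mono (by omega)
  -- An element of `L N` is determined by its action on level `n + N`: that action fixes the
  -- beginning of `f (k • ξ)` and the value of `c`, while the tail of `f (k • ξ)` is that of `f ξ`.
  · refine Finite.of_injective
      (fun (k : L N) (v : Word E (n + N)) => ((k : K) : TreeAut E).onLevel (n + N) v) ?_
    intro k k' hkk'
    refine Subtype.ext (Subtype.ext (Subtype.ext (eq_of_forall_smul_eq fun ξ => ?_)))
    have h1 : Agree (n + N) (k • ξ) (k' • ξ) := by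
      refine (beginning_smul _ ξ _).trans (Eq.trans ?_ (beginning_smul _ ξ _).symm)
      exact congrFun hkk' _
    have h2 : c ((k • ξ).beginning n) = c ((k' • ξ).beginning n) :=
      congrArg c (h1.mono (Nat.le_add_right n N))
    have h3 : TailEq (n + N) (f (k • ξ)) (f (k' • ξ)) := (k.2 ξ).trans (k'.2 ξ).symm
    have h4 : f (k • ξ) = f (k' • ξ) := by
      refine h3.eq_of_agree ?_
      simp only [hf, h2]
      exact h1.smul _
    simp only [hf, h2] at h4
    exact smul_left_cancel _ h4
  -- Near each point the tails agree from some place on; compactness makes this place uniform.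
  · obtain ⟨N, hN⟩ := exists_uniform
      (P := fun N ξ => n ≤ N ∧ TailEq N (f (k • ξ)) (f ξ))
      (fun M N ξ hMN hM => ⟨hM.1.trans hMN, hM.2.mono hMN⟩) (fun ξ => by
        obtain ⟨N, hN⟩ := h k k.2 ξ
        refine ⟨max n N, fun η hη => ⟨le_max_left _ _, ?_⟩⟩
        have hη' : Agree n η ξ := hη.mono (le_max_left _ _)
        have h1 := (hN η (hη.mono (le_max_right _ _))).mono (le_max_right n N)
        have e1 : (k • η).beginning n = ((k : G) • ξ).beginning n := hη'.smul (k : TreeAut E)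
        have e2 : η.beginning n = ξ.beginning n := hη'
        simp only [hf]
        rw [e1, e2]
        rw [mul_smul] at h1
        exact h1)
    exact ⟨N, fun ξ => (hN ξ).2.mono (Nat.le_add_left N n)⟩

/-! ## Configurations of germs -/

variable {G : Subgroup (TreeAut E)}

/-- Sets of elements of `G`, with the action by right translations. -/
def GermClass (G : Subgroup (TreeAut E)) : Type u := Set G

instance : MulAction G (GermClass G) where
  smul g s := {k : G | (show Set G from s) (k * g)}
  one_smul s := by
    change {k : G | (show Set G from s) (k * 1)} = s
    simp only [mul_one]
    rfl
  mul_smul g h s := by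
    change {k : G | (show Set G from s) (k * (g * h))} =
      {k : G | (show Set G from s) (k * g * h)}
    simp only [mul_assoc]

/-- The elements of `G` with the same germ at `ξ` as `g`, up to a finitary germ. -/
def germClass (ξ : Boundary E) (g : G) : GermClass G := {k : G | TailRel ξ (k : TreeAut E) g}

theorem germClass_eq_iff {ξ : Boundary E} {g h : G} :
    germClass ξ g = germClass ξ h ↔ TailRel ξ (g : TreeAut E) h := by
  constructor
  · intro H
    have : (germClass ξ h : Set G) g := by
      rw [← H]
      exact TailRel.refl ξ _
    exact this
  · intro H
    exact Set.ext fun k => ⟨fun hk => TailRel.trans hk H, fun hk => TailRel.trans hk H.symm⟩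

theorem smul_germClass (g : G) (ξ : Boundary E) (h : G) :
    g • germClass ξ h = germClass (g • ξ) (h * g⁻¹) := by
  refine Set.ext fun k => ?_
  change TailRel ξ _ _ ↔ TailRel ((g : TreeAut E) • ξ) _ _
  rw [TailRel.smul_iff]
  simp

/-- The classes of germs at `ξ` modulo finitary germs. -/
def germClassesAt (G : Subgroup (TreeAut E)) (ξ : Boundary E) : Set (GermClass G) :=
  Set.range (germClass ξ)

theorem smul_mem_germClassesAt (g : G) (ξ : Boundary E) {s : GermClass G}
    (hs : s ∈ germClassesAt G ξ) : g • s ∈ germClassesAt G (g • ξ) := by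
  obtain ⟨h, rfl⟩ := hs
  exact ⟨h * g⁻¹, (smul_germClass g ξ h).symm⟩

/-- Push the mean of the isotropy group forward by sending `a` to the class of `a⁻¹`. The inverse
appears because `G` acts on classes by right translation by `g⁻¹`, and it makes the map equivariant
for the stabilizer; then transport along orbits. -/
theorem exists_germClass_means
    (hG : ∀ ξ : Boundary E, IsAmenableGroup (IsotropyGroup G ξ)) :
    ∃ m : Boundary E → (GermClass G → ℝ) → ℝ, (∀ ξ, IsMean (m ξ)) ∧
      (∀ (g : G) ξ f, BoundedFun f → m (g • ξ) f = m ξ (fun s => f (g • s))) ∧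
      ∀ ξ f f', Set.EqOn f f' (germClassesAt G ξ) → m ξ f = m ξ f' := by
  choose n hn hinv using fun ξ => isAmenableAction_iff.1 (hG ξ)
  have hclass : ∀ (ξ : Boundary E) (a b : MulAction.stabilizer G ξ),
      (a : IsotropyGroup G ξ) = b → germClass ξ (a : G)⁻¹ = germClass ξ (b : G)⁻¹ := by
    intro ξ a b hab
    obtain ⟨N, hN⟩ := Boundary.eventually_nhds_iff.1 (QuotientGroup.eq.1 hab)
    refine germClass_eq_iff.2 ⟨N, fun η hη => ?_⟩
    have hbξ : (b : G)⁻¹ • ξ = ξ := (b⁻¹).2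
    have h1 : Agree N ((b : G)⁻¹ • η) ξ := by
      have : Agree N ((b : G)⁻¹ • η) ((b : G)⁻¹ • ξ) := hη.smul (((b : G)⁻¹ : G) : TreeAut E)
      rwa [hbξ] at this
    have h2 : ((a : G)⁻¹ * (b : G)) • ((b : G)⁻¹ • η) = (b : G)⁻¹ • η := hN _ h1
    rw [mul_smul, smul_inv_smul] at h2
    change TailEq N ((a : G)⁻¹ • η) ((b : G)⁻¹ • η)
    rw [h2]
    exact TailEq.refl _ _
  have hψ : ∀ ξ : Boundary E, ∃ ψ : IsotropyGroup G ξ → GermClass G,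
      (∀ q, ψ q ∈ germClassesAt G ξ) ∧
        ∀ (a : MulAction.stabilizer G ξ) (q : IsotropyGroup G ξ),
          ψ ((a : IsotropyGroup G ξ) * q) = (a : G) • ψ q := by
    intro ξ
    set ψ : IsotropyGroup G ξ → GermClass G := fun q =>
      germClass ξ ((q.out : MulAction.stabilizer G ξ) : G)⁻¹ with hdef
    have hmk : ∀ b : MulAction.stabilizer G ξ,
        ψ (b : IsotropyGroup G ξ) = germClass ξ (b : G)⁻¹ :=
      fun b => hclass ξ _ b (QuotientGroup.out_eq' _)
    refine ⟨ψ, fun q => ⟨_, rfl⟩, fun a q => ?_⟩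
    induction q using QuotientGroup.induction_on with
    | H b =>
      have haξ : (a : G) • ξ = ξ := a.2
      rw [← QuotientGroup.mk_mul, hmk, hmk, smul_germClass, haξ, Subgroup.coe_mul, mul_inv_rev]
  choose ψ hψD hψ using hψ
  refine exists_equivariant_means (fun ξ f => n ξ fun q => f (ψ ξ q)) (fun ξ => (hn ξ).map _)
    (fun ξ g hg f hf => ?_) (germClassesAt G) (fun g ξ s hs => smul_mem_germClassesAt g ξ hs)
    (fun ξ f f' hff' => ?_)
  · refine Eq.trans (congrArg (n ξ) (funext fun q => ?_))
      (hinv ξ ((⟨g, hg⟩ : MulAction.stabilizer G ξ) : IsotropyGroup G ξ)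
        (fun q => f (ψ ξ q)) (hf.comp _))
    exact congrArg f (hψ ξ ⟨g, hg⟩ q).symm
  · congr 1
    funext q
    exact hff' (hψD ξ q)

/-- Families of sets of elements of `G` indexed by infinite words. -/
def GermField (G : Subgroup (TreeAut E)) : Type u := Boundary E → GermClass G

instance : MulAction G (GermField G) where
  smul g φ := fun ξ => g • φ (g⁻¹ • ξ)
  one_smul φ := by
    funext ξ
    change (1 : G) • φ ((1 : G)⁻¹ • ξ) = φ ξ
    rw [inv_one, one_smul, one_smul]
  mul_smul g h φ := by
    funext ξ
    change (g * h) • φ ((g * h)⁻¹ • ξ) = g • h • φ (h⁻¹ • g⁻¹ • ξ)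
    rw [mul_inv_rev, mul_smul, mul_smul]

theorem GermField.smul_apply (g : G) (φ : GermField G) (ξ : Boundary E) :
    (g • φ) ξ = g • φ (g⁻¹ • ξ) := rfl

/-- The finitely supported families of classes of germs modulo finitary germs. -/
def configurations (hG : ∀ g ∈ G, TreeAut.IsBounded g) : SubMulAction G (GermField G) where
  carrier := {φ | (∀ ξ, φ ξ ∈ germClassesAt G ξ) ∧ {ξ | φ ξ ≠ germClass ξ 1}.Finite}
  smul_mem' := by
    rintro g φ ⟨h1, h2⟩
    refine ⟨fun ξ => ?_, ?_⟩
    · have := smul_mem_germClassesAt g _ (h1 (g⁻¹ • ξ))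
      rwa [smul_inv_smul] at this
    -- New non-trivial classes can arise only where the germ of `g⁻¹` is not finitary.
    · refine ((h2.image (g • ·)).union (finite_singularSet (hG _ (g⁻¹).2))).subset fun ξ hξ => ?_
      by_contra hnot
      rw [Set.mem_union, not_or] at hnot
      have h3 : φ (g⁻¹ • ξ) = germClass (g⁻¹ • ξ) 1 := by
        by_contra h
        exact hnot.1 ⟨_, h, smul_inv_smul g ξ⟩
      refine hξ ?_
      rw [GermField.smul_apply, h3, smul_germClass, smul_inv_smul, one_mul, germClass_eq_iff]
      exact TailRel.of_notMem_singularSet hnot.2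

/-- Representatives of the classes can be chosen locally constant up to finitary germs. After
twisting by this choice, an element fixing `φ` becomes locally finitary, and
`isAmenableGroup_of_tailRel` applies. -/
theorem isAmenableGroup_stabilizer_configuration [∀ i, Finite (E i)] [∀ i, Nonempty (E i)]
    (hG : ∀ g ∈ G, TreeAut.IsBounded g) (φ : configurations hG) :
    IsAmenableGroup (MulAction.stabilizer G φ) := by
  classical
  obtain ⟨φ, hφ, hfin⟩ := φ
  have hrep : ∀ ξ, ∃ g : G, φ ξ = germClass ξ g ∧ (φ ξ = germClass ξ 1 → g = 1) := by
    intro ξ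
    by_cases h : φ ξ = germClass ξ 1
    · exact ⟨1, h, fun _ => rfl⟩
    · obtain ⟨g, hg⟩ := hφ ξ
      exact ⟨g, hg.symm, fun h' => absurd h' h⟩
  choose g hg hg1 using hrep
  set A := hfin.toFinset with hA
  have hgA : ∀ ξ, ξ ∉ A → g ξ = 1 := by
    intro ξ hξ
    refine hg1 ξ ?_
    by_contra h
    exact hξ (hfin.mem_toFinset.2 h)
  have hs : ∀ ξ, (singularSet (g ξ : TreeAut E)).Finite := fun ξ =>
    finite_singularSet (hG _ (g ξ).2)
  -- On this level the cylinder around `α ∈ A` contains no other point of `A` and no singular point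
  -- of `g α` other than possibly `α`. Thus using `g α` on the whole cylinder is harmless away from
  -- `α`.
  obtain ⟨n, hn⟩ := exists_injOn_beginning (A ∪ A.biUnion fun ξ => (hs ξ).toFinset)
  set c : Word E n → TreeAut E := fun v =>
    if h : ∃ α ∈ A, α.beginning n = v then (g h.choose : TreeAut E) else 1 with hc
  have hcg : ∀ ξ, TailRel ξ (c (ξ.beginning n)) (g ξ) := by
    intro ξ
    by_cases h : ∃ α ∈ A, α.beginning n = ξ.beginning n
    · have hcξ : c (ξ.beginning n) = (g h.choose : TreeAut E) := dif_pos h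
      rw [hcξ]
      obtain ⟨hα, hαξ⟩ := h.choose_spec
      set α := h.choose
      by_cases hξ : ξ = α
      · rw [hξ]
        exact TailRel.refl _ _
      · have hξA : ξ ∉ A := fun hmem => hξ (hn ξ (Finset.mem_union_left _ hmem) α
          (Finset.mem_union_left _ hα) hαξ.symm)
        rw [hgA ξ hξA]
        refine TailRel.of_notMem_singularSet fun hmem => hξ ?_
        exact hn ξ (Finset.mem_union_right _ (Finset.mem_biUnion.2
          ⟨α, hα, (hs α).mem_toFinset.2 hmem⟩)) α (Finset.mem_union_left _ hα) hαξ.symm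
    · have hcξ : c (ξ.beginning n) = 1 := dif_neg h
      rw [hcξ, hgA ξ fun hmem => h ⟨ξ, hmem, rfl⟩]
      exact TailRel.refl _ _
  refine isAmenableGroup_of_tailRel _ c fun k hk ξ => ?_
  have hkφ : k • φ = φ := congrArg Subtype.val (MulAction.mem_stabilizer_iff.1 hk)
  have h1 : germClass (k • ξ) (g (k • ξ)) = germClass (k • ξ) (g ξ * k⁻¹) := by
    rw [← hg, ← smul_germClass, ← hg]
    nth_rewrite 1 [← hkφ]
    rw [GermField.smul_apply, inv_smul_smul]
  have h2 := (hcg (k • ξ)).trans (germClass_eq_iff.1 h1)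
  have h3 : TailRel ξ (c ((k • ξ).beginning n) * k) (((g ξ * k⁻¹ : G) : TreeAut E) * k) :=
    TailRel.mul_right (f := (k : TreeAut E)) h2
  refine (TailRel.trans h3 ?_).trans (hcg ξ).symm
  simp only [Subgroup.coe_mul, InvMemClass.coe_inv, inv_mul_cancel_right]
  exact TailRel.refl _ _

end RootedTree

/-! ## Orderings of finite sets -/

/-- The lists enumerating a finite set without repetitions. -/
def Finset.orderings {X : Type*} (A : Finset X) : Finset (List X) :=
  ⟨A.val.lists, Multiset.lists_nodup_finset A⟩

theorem Finset.mem_orderings {X : Type*} {A : Finset X} {l : List X} :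
    l ∈ A.orderings ↔ A.val = (l : Multiset X) :=
  Multiset.mem_lists_iff _ _

theorem Finset.orderings_nonempty {X : Type*} (A : Finset X) : A.orderings.Nonempty :=
  ⟨A.toList, Finset.mem_orderings.2 A.coe_toList.symm⟩

theorem Finset.mem_of_mem_orderings {X : Type*} {A : Finset X} {l : List X}
    (hl : l ∈ A.orderings) {x : X} : x ∈ l ↔ x ∈ A := by
  rw [← Finset.mem_val, Finset.mem_orderings.1 hl, Multiset.mem_coe]

theorem Finset.orderings_map {X : Type*} (A : Finset X) (e : X ≃ X) :
    (A.map e.toEmbedding).orderings =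
      A.orderings.map ⟨List.map e, List.map_injective_iff.2 e.injective⟩ := by
  ext l
  rw [Finset.mem_orderings, Finset.mem_map, Finset.map_val]
  constructor
  · intro h
    refine ⟨l.map e.symm, ?_, ?_⟩
    · rw [Finset.mem_orderings, ← Multiset.map_coe, ← h, Multiset.map_map]
      simp
    · simp
  · rintro ⟨l', hl', rfl⟩
    rw [Finset.mem_orderings.1 hl']
    rfl

namespace RootedTree

universe u

variable {E : ℕ → Type u} {G : Subgroup (TreeAut E)} {hG : ∀ g ∈ G, TreeAut.IsBounded g}

open Boundary

/-! ## The mean on configurations -/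

theorem configuration_ext {φ ψ : configurations hG}
    (h : ∀ ξ, φ.1 ξ = ψ.1 ξ) : φ = ψ :=
  Subtype.ext (funext h)

open Classical in
/-- The configuration with the class at `ξ` replaced by `s`, if `s` is a class of germs at `ξ`. -/
noncomputable def updateConfiguration (φ : configurations hG) (ξ : Boundary E)
    (s : GermClass G) : configurations hG :=
  if hs : s ∈ germClassesAt G ξ then
    ⟨(Function.update (show Boundary E → GermClass G from φ.1) ξ s : Boundary E → GermClass G), by
      refine ⟨fun η => ?_, ?_⟩
      · by_cases h : η = ξ
        · subst h
          rw [Function.update_self]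
          exact hs
        · rw [Function.update_of_ne h]
          exact φ.2.1 η
      · refine (φ.2.2.union (Set.finite_singleton ξ)).subset fun η hη => ?_
        by_cases h : η = ξ
        · exact Or.inr h
        · refine Or.inl ?_
          rw [Set.mem_ofPred_eq, Function.update_of_ne h] at hη
          exact hη⟩
  else φ

open Classical in
theorem updateConfiguration_self (φ : configurations hG) {ξ : Boundary E} {s : GermClass G}
    (hs : s ∈ germClassesAt G ξ) : (updateConfiguration φ ξ s).1 ξ = s := by
  rw [updateConfiguration, dif_pos hs]
  exact Function.update_self ξ s φ.1

open Classical in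
theorem updateConfiguration_of_ne (φ : configurations hG) {ξ η : Boundary E} (s : GermClass G)
    (h : η ≠ ξ) : (updateConfiguration φ ξ s).1 η = φ.1 η := by
  rw [updateConfiguration]
  split_ifs
  · exact Function.update_of_ne h s φ.1
  · rfl

theorem smul_updateConfiguration (g : G) (φ : configurations hG) {ξ : Boundary E}
    {s : GermClass G} (hs : s ∈ germClassesAt G ξ) :
    updateConfiguration (g • φ) (g • ξ) (g • s) = g • updateConfiguration φ ξ s := by
  refine configuration_ext fun η => ?_
  have hsmul : ∀ ψ : configurations hG, (g • ψ).1 η = g • ψ.1 (g⁻¹ • η) := fun _ => rfl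
  rw [hsmul]
  by_cases h : η = g • ξ
  · rw [h, updateConfiguration_self _ (smul_mem_germClassesAt g ξ hs), inv_smul_smul,
      updateConfiguration_self _ hs]
  · rw [updateConfiguration_of_ne _ _ h, updateConfiguration_of_ne _ _ fun h' => h
      (inv_smul_eq_iff.1 h'), hsmul]

/-- The mean of a function over the configurations obtained by choosing successively at random
the classes of germs at the members of a list. -/
noncomputable def listMean (m : Boundary E → (GermClass G → ℝ) → ℝ) :
    List (Boundary E) → configurations hG → (configurations hG → ℝ) → ℝ
  | [], φ, f => f φ
  | ξ :: l, φ, f => m ξ fun s => listMean m l (updateConfiguration φ ξ s) f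

variable {m : Boundary E → (GermClass G → ℝ) → ℝ}

theorem isMean_listMean (hm : ∀ ξ, IsMean (m ξ)) (l : List (Boundary E))
    (φ : configurations hG) : IsMean (listMean m l φ) := by
  induction l generalizing φ with
  | nil => exact IsMean.dirac φ
  | cons ξ l ih => exact (hm ξ).bind fun s => ih _

/-- The entries at the members of `l` are overwritten, so the initial configuration matters only off
`l`. -/
theorem listMean_congr (hmD : ∀ ξ f f', Set.EqOn f f' (germClassesAt G ξ) → m ξ f = m ξ f')
    (l : List (Boundary E)) {φ ψ : configurations hG} (h : ∀ ξ, ξ ∉ l → φ.1 ξ = ψ.1 ξ)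
    (f : configurations hG → ℝ) : listMean m l φ f = listMean m l ψ f := by
  induction l generalizing φ ψ with
  | nil => rw [configuration_ext fun ξ => h ξ List.not_mem_nil]
  | cons ξ l ih =>
    refine hmD _ _ _ fun s hs => ih fun η hη => ?_
    by_cases hηξ : η = ξ
    · rw [hηξ, updateConfiguration_self _ hs, updateConfiguration_self _ hs]
    · rw [updateConfiguration_of_ne _ _ hηξ, updateConfiguration_of_ne _ _ hηξ]
      exact h η (List.not_mem_cons_of_ne_of_not_mem hηξ hη)

theorem listMean_smul (hm : ∀ ξ, IsMean (m ξ))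
    (hmG : ∀ (g : G) ξ f, BoundedFun f → m (g • ξ) f = m ξ (fun s => f (g • s)))
    (hmD : ∀ ξ f f', Set.EqOn f f' (germClassesAt G ξ) → m ξ f = m ξ f')
    (g : G) (l : List (Boundary E)) (φ : configurations hG) {f : configurations hG → ℝ}
    (hf : BoundedFun f) :
    listMean m (l.map (g • ·)) (g • φ) f = listMean m l φ (fun ψ => f (g • ψ)) := by
  induction l generalizing φ with
  | nil => rfl
  | cons ξ l ih =>
    rw [List.map_cons, listMean, listMean, hmG]
    · refine hmD _ _ _ fun s hs => ?_
      rw [smul_updateConfiguration g φ hs, ih]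
    · exact IsMean.boundedFun_apply (fun s => isMean_listMean hm _ _) hf

/-- The configuration of trivial germs. -/
def trivialConfiguration (hG : ∀ g ∈ G, TreeAut.IsBounded g) : configurations hG :=
  ⟨fun ξ => germClass ξ 1, fun _ => ⟨1, rfl⟩, by simp⟩

/-- By equivariance, translating by `g` amounts to replacing the initial configuration `φ₀` by `g⁻¹
• φ₀`. The two differ only on the singular set of `g`, which almost every random set `A` contains,
and there the entries are resampled. -/
theorem isAmenableAction_configurations [∀ i, Finite (E i)]
    (hG : ∀ g ∈ G, TreeAut.IsBounded g)
    (hiso : ∀ ξ : Boundary E, IsAmenableGroup (IsotropyGroup G ξ)) :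
    IsAmenableAction G (configurations hG) := by
  obtain ⟨m, hm, hmG, hmD⟩ := exists_germClass_means hiso
  obtain ⟨M, hM, hMZ, hMG⟩ := (hasSmallCapacity hG).exists_invariant_mean
  set φ₀ := trivialConfiguration hG with hφ₀
  -- Finitely additive means need not satisfy Fubini, so successive choices may depend on their
  -- order. Averaging over all orderings of `A` makes the construction equivariant.
  set avg : Finset (Boundary E) → (configurations hG → ℝ) → ℝ := fun A f =>
    (∑ l ∈ A.orderings, listMean m l φ₀ f) / A.orderings.card with havg
  have havgM : ∀ A, IsMean (avg A) := fun A =>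
    IsMean.average A.orderings_nonempty _ fun l => isMean_listMean hm l φ₀
  refine isAmenableAction_iff.2 ⟨_, hM.bind havgM, fun g f hf => ?_⟩
  rw [← hMG g _ (IsMean.boundedFun_apply havgM hf)]
  refine hMZ (finite_singularSet (hG _ g.2)).toFinset _ _
    (IsMean.boundedFun_apply havgM (hf.comp _)) ((IsMean.boundedFun_apply havgM hf).comp _)
    fun A hA => ?_
  simp only [havg, Finset.orderings_map, Finset.sum_map, Finset.card_map]
  congr 1
  refine Finset.sum_congr rfl fun l hl => ?_
  have h1 : listMean m (l.map (g • ·)) φ₀ f =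
      listMean m l (g⁻¹ • φ₀) (fun ψ => f (g • ψ)) := by
    rw [← listMean_smul hm hmG hmD g l _ hf, smul_inv_smul]
  refine Eq.trans ?_ h1.symm
  refine listMean_congr hmD l (fun ξ hξ => ?_) _
  have h2 : (g⁻¹ • φ₀).1 ξ = g⁻¹ • germClass (g⁻¹⁻¹ • ξ) 1 := rfl
  have h3 : g⁻¹ • germClass (g⁻¹⁻¹ • ξ) 1 = germClass ξ g := by
    rw [smul_germClass, smul_inv_smul, inv_inv, one_mul]
  refine Eq.trans ?_ (h2.trans h3).symm
  refine germClass_eq_iff.2 (TailRel.of_notMem_singularSet fun hmem => hξ ?_).symm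
  rw [Finset.mem_of_mem_orderings hl]
  exact hA ((Set.Finite.mem_toFinset _).2 hmem)

theorem finite_treeAut_of_isEmpty [∀ i, Finite (E i)] {i : ℕ} (hi : IsEmpty (E i)) :
    Finite (TreeAut E) := by
  have : Finite (Vertex E) := by
    have hempty : ∀ n, i < n → IsEmpty (Word E n) := fun n hn => ⟨fun v => hi.false (v ⟨i, hn⟩)⟩
    refine Finite.of_injective (β := Σ n : Fin (i + 1), Word E n)
      (fun x => ⟨⟨x.1, ?_⟩, x.2⟩) ?_
    · by_contra h
      exact (hempty x.1 (by omega)).false x.2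
    · rintro ⟨n, v⟩ ⟨k, w⟩ h
      obtain ⟨h1, h2⟩ := Sigma.mk.inj h
      obtain rfl : n = k := congrArg Fin.val h1
      exact congrArg _ (eq_of_heq h2)
  exact Finite.of_injective (fun g : TreeAut E => (g.1 : Vertex E → Vertex E))
    fun g h hgh => Subtype.ext (RelIso.ext (congrFun hgh))

theorem isAmenableGroup_of_isotropyGroup [∀ i, Finite (E i)]
    (hG : ∀ g ∈ G, TreeAut.IsBounded g)
    (hiso : ∀ ξ : Boundary E, IsAmenableGroup (IsotropyGroup G ξ)) : IsAmenableGroup G := by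
  by_cases hne : ∀ i, Nonempty (E i)
  · obtain ⟨M, hM, hMG⟩ := isAmenableAction_iff.1 (isAmenableAction_configurations hG hiso)
    exact isAmenableGroup_of_stabilizers hM hMG (isAmenableGroup_stabilizer_configuration hG)
  -- If some alphabet is empty, the boundary is empty and the hypothesis on germs is void, but the
  -- tree and its automorphism group are finite.
  · push Not at hne
    obtain ⟨i, hi⟩ := hne
    have := finite_treeAut_of_isEmpty hi
    exact isAmenableGroup_of_monotone_finite (fun _ => ⊤) (fun _ _ _ => le_rfl)
      (fun _ => inferInstance) fun g => ⟨0, Subgroup.mem_top g⟩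

end RootedTree

namespace RootedTree

universe u

variable {E : ℕ → Type u} {G : Subgroup (TreeAut E)}

open Boundary

/-! ## Free subgroups -/

/-- An extensively amenable action is amenable on every orbit. -/
theorem exists_invariant_mean_orbit {H X : Type*} [Group H] [MulAction H X]
    {M : (Finset X → ℝ) → ℝ} (hM : IsMean M)
    (hMZ : ∀ (Z : Finset X) f f', BoundedFun f → BoundedFun f' → (∀ A, Z ⊆ A → f A = f' A) →
      M f = M f')
    (hMH : ∀ (h : H) f, BoundedFun f →
      M (fun A => f (A.map (MulAction.toPerm h).toEmbedding)) = M f) (x : X) :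
    ∃ m : (MulAction.orbit H x → ℝ) → ℝ, IsMean m ∧ IsMean.Invariant H m := by
  classical
  set O := MulAction.orbit H x with hO
  set x₀ : O := ⟨x, MulAction.mem_orbit_self x⟩
  set tr : Finset X → Finset O := fun A => A.subtype (· ∈ O) with htr
  -- The uniform mean on the part of `A` in the orbit. The default at `x₀` never matters, since
  -- almost every `A` contains `x`.
  set k : Finset X → (O → ℝ) → ℝ := fun A f =>
    if (tr A).Nonempty then (∑ y ∈ tr A, f y) / (tr A).card else f x₀ with hk
  have hkM : ∀ A, IsMean (k A) := by
    intro A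
    by_cases h : (tr A).Nonempty
    · have := IsMean.average h (fun y (f : O → ℝ) => f y) fun y => IsMean.dirac y
      simpa only [hk, if_pos h] using this
    · simpa only [hk, if_neg h] using IsMean.dirac x₀
  refine ⟨_, hM.bind hkM, fun h f hf => ?_⟩
  rw [← hMH h _ (IsMean.boundedFun_apply hkM hf)]
  refine hMZ {x} _ _ (IsMean.boundedFun_apply hkM (hf.comp _))
    ((IsMean.boundedFun_apply hkM hf).comp _) fun A hA => ?_
  have hxA : x ∈ A := hA (Finset.mem_singleton_self x)
  have h1 : (tr A).Nonempty := ⟨x₀, Finset.mem_subtype.2 hxA⟩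
  have h2 : tr (A.map (MulAction.toPerm h).toEmbedding) =
      (tr A).map (MulAction.toPerm h : Equiv.Perm O).toEmbedding := by
    ext y
    rw [Finset.mem_subtype, Finset.mem_map_equiv, Finset.mem_map_equiv, Finset.mem_subtype]
    rfl
  simp only [hk, h2, Finset.map_nonempty, if_pos h1, Finset.card_map, Finset.sum_map]
  rfl

/-- The elements that fix the beginnings of length `n` of all infinite words. -/
def levelStabilizer (F : Subgroup G) (n : ℕ) : Subgroup F where
  carrier := {h | ∀ ξ : Boundary E, Agree n (h • ξ) ξ}
  one_mem' ξ := by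
    rw [one_smul]
    exact Agree.refl n ξ
  mul_mem' {a b} ha hb ξ := by
    rw [mul_smul]
    exact (ha (b • ξ)).trans (hb ξ)
  inv_mem' {a} ha ξ := by
    have := ha (a⁻¹ • ξ)
    rw [smul_inv_smul] at this
    exact this.symm

theorem exists_pow_mem_levelStabilizer [∀ i, Finite (E i)] (F : Subgroup G) (n : ℕ) (h : F) :
    ∃ k : ℕ, k ≠ 0 ∧ h ^ k ∈ levelStabilizer F n := by
  obtain ⟨i, j, hij, hne⟩ := Finite.exists_ne_map_eq_of_infinite
    fun (i : ℕ) (v : Word E n) => ((h ^ i : F) : TreeAut E).onLevel n v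
  wlog hlt : i < j generalizing i j
  · exact this j i hij.symm hne.symm (by omega)
  refine ⟨j - i, by omega, fun ξ => ?_⟩
  have h1 : Agree n ((h ^ (j - i)) • (h ^ i) • h⁻¹ ^ i • ξ) ((h ^ i) • h⁻¹ ^ i • ξ) := by
    rw [smul_smul, ← pow_add, Nat.sub_add_cancel hlt.le]
    refine (beginning_smul _ _ _).trans (Eq.trans ?_ (beginning_smul _ _ _).symm)
    exact (congrFun hne _).symm
  rwa [inv_pow, smul_inv_smul] at h1

/-- The elements of the level stabilizer acting trivially on the infinite words with a given
beginning. -/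
def cylinderFixer (F : Subgroup G) {n : ℕ} (v : Word E n) : Subgroup (levelStabilizer F n) where
  carrier := {h | ∀ ξ : Boundary E, ξ.beginning n = v → h • ξ = ξ}
  one_mem' ξ _ := one_smul _ ξ
  mul_mem' {a b} ha hb ξ hξ := by rw [mul_smul, hb ξ hξ, ha ξ hξ]
  inv_mem' {a} ha ξ hξ := by rw [inv_smul_eq_iff, ha ξ hξ]

/-- Elements of the level stabilizer preserve each cylinder of level `n`; this is the reason for
passing to that subgroup. -/
theorem normal_cylinderFixer (F : Subgroup G) {n : ℕ} (v : Word E n) :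
    (cylinderFixer F v).Normal where
  conj_mem a ha h ξ hξ := by
    have h1 : a • h⁻¹ • ξ = h⁻¹ • ξ := ha _ (Eq.trans ((h⁻¹).2 ξ) hξ)
    rw [mul_smul, mul_smul, h1, smul_inv_smul]

/-- In a free non-abelian group of automorphisms there is a point with no nontrivial element acting
trivially on a neighbourhood of it. -/
theorem exists_forall_germ_ne [∀ i, Finite (E i)] [∀ i, Nonempty (E i)] (F : Subgroup G)
    [IsFreeGroup F] {a b : F} (hab : ¬ Commute a b) :
    ∃ ξ : Boundary E, ∀ h : F, (∀ᶠ η in 𝓝 ξ, h • η = η) → h = 1 := by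
  have htf := IsFreeGroup.isMulTorsionFree (F := F)
  by_contra! H
  -- If every point had a non-trivial element acting trivially nearby, then by compactness every
  -- cylinder of one fixed level would be fixed pointwise by such an element.
  obtain ⟨n, hn⟩ := exists_uniform
    (P := fun n ξ => ∃ h : F, h ≠ 1 ∧ ∀ η : Boundary E, Agree n η ξ → h • η = η)
    (fun m n ξ hmn ⟨h, h1, h2⟩ => ⟨h, h1, fun η hη => h2 η (hη.mono hmn)⟩) (fun ξ => by
      obtain ⟨h, h1, h2⟩ := H ξ
      obtain ⟨n, hn⟩ := Boundary.eventually_nhds_iff.1 h1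
      exact ⟨n, fun η hη => ⟨h, h2, fun ζ hζ => hn ζ (hζ.trans hη)⟩⟩)
  have hpow : ∀ h : F, h ≠ 1 → ∃ k : ℕ, h ^ k ∈ levelStabilizer F n ∧ h ^ k ≠ 1 := by
    intro h hh
    obtain ⟨k, hk, hmem⟩ := exists_pow_mem_levelStabilizer F n h
    exact ⟨k, hmem, fun h' => hh ((pow_eq_one_iff_left hk).1 h')⟩
  have ha : a ≠ 1 := fun h => hab (by rw [h]; exact Commute.one_left b)
  have hb : b ≠ 1 := fun h => hab (by rw [h]; exact Commute.one_right a)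
  obtain ⟨i, hai, hai1⟩ := hpow a ha
  obtain ⟨j, hbj, hbj1⟩ := hpow b hb
  -- Non-trivial powers of non-commuting elements do not commute in a free group, so the level
  -- stabilizer is again free non-abelian.
  have hab' : ¬ Commute (⟨a ^ i, hai⟩ : levelStabilizer F n) ⟨b ^ j, hbj⟩ := by
    intro h
    have h1 : Commute (a ^ i) (b ^ j) := congrArg Subtype.val h
    have h2 : Commute a (b ^ j) :=
      IsFreeGroup.commute_trans hai1 ((Commute.refl a).pow_left i) h1
    exact hab (IsFreeGroup.commute_trans hbj1 h2.symm ((Commute.refl b).pow_left j))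
  have := Fintype.ofFinite (Word E n)
  -- The fixers of the finitely many cylinders are non-trivial normal subgroups, yet an element in
  -- all of them fixes the whole boundary.
  refine IsFreeGroup.iInf_ne_bot hab' (Finset.univ : Finset (Word E n)) (cylinderFixer F)
    (normal_cylinderFixer F) (fun v hv => ?_) ?_
  · obtain ⟨ξ, rfl⟩ := exists_beginning_eq v
    obtain ⟨h, h1, h2⟩ := hn ξ
    obtain ⟨k, hk, hk1⟩ := hpow h h1
    have hmem : (⟨h ^ k, hk⟩ : levelStabilizer F n) ∈ cylinderFixer F (ξ.beginning n) := by
      intro η hη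
      have : h ∈ MulAction.stabilizer F η := h2 η hη
      exact pow_mem this k
    rw [hv, Subgroup.mem_bot] at hmem
    exact hk1 (congrArg Subtype.val hmem)
  · rw [eq_bot_iff]
    intro h hh
    simp only [Subgroup.mem_iInf, Finset.mem_univ, true_implies] at hh
    rw [Subgroup.mem_bot]
    refine Subtype.ext (Subtype.ext (Subtype.ext (eq_of_forall_smul_eq fun ξ => ?_)))
    exact (hh (ξ.beginning n) ξ rfl).trans (one_smul (TreeAut E) ξ).symm

/-- The germ map embeds the stabilizer in the isotropy group, and the stabilizer is free as a
subgroup of `F`; two non-commuting elements would give a forbidden free subgroup. -/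
theorem commute_stabilizer_of_isotropyGroup (F : Subgroup G) [IsFreeGroup F] {ξ : Boundary E}
    (hF : ∀ h : F, (∀ᶠ η in 𝓝 ξ, h • η = η) → h = 1)
    (hξ : ¬ HasNonabelianFreeSubgroup (IsotropyGroup G ξ)) (a b : MulAction.stabilizer F ξ) :
    Commute a b := by
  set ι : MulAction.stabilizer F ξ →* MulAction.stabilizer G ξ :=
    { toFun := fun h => ⟨((h : F) : G), h.2⟩
      map_one' := rfl
      map_mul' := fun _ _ => rfl } with hι
  set q : MulAction.stabilizer F ξ →* IsotropyGroup G ξ :=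
    (QuotientGroup.mk' (germKernel G ξ)).comp ι with hq
  have hinj : Function.Injective q := by
    rw [injective_iff_map_eq_one]
    intro h hh
    have hmem : ι h ∈ germKernel G ξ := (QuotientGroup.eq_one_iff _).1 hh
    exact Subtype.ext (hF h hmem)
  have hfree : IsFreeGroup q.range := IsFreeGroup.ofMulEquiv (MonoidHom.ofInjective hinj)
  by_contra hab
  refine hξ ⟨q.range, hfree, ⟨q a, a, rfl⟩, ⟨q b, b, rfl⟩, fun h => hab (hinj ?_)⟩
  rw [map_mul, map_mul]
  exact congrArg Subtype.val h

theorem not_hasNonabelianFreeSubgroup_of_isotropyGroup [∀ i, Finite (E i)]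
    (hG : ∀ g ∈ G, TreeAut.IsBounded g)
    (hiso : ∀ ξ : Boundary E, ¬ HasNonabelianFreeSubgroup (IsotropyGroup G ξ)) :
    ¬ HasNonabelianFreeSubgroup G := by
  rintro ⟨F, hF, a, b, hab⟩
  have hab : ¬ Commute a b := hab
  refine IsFreeGroup.not_isAmenableGroup hab ?_
  by_cases hne : ∀ i, Nonempty (E i)
  · obtain ⟨M, hM, hMZ, hMG⟩ := (hasSmallCapacity hG).exists_invariant_mean
    obtain ⟨ξ, hξ⟩ := exists_forall_germ_ne F hab
    obtain ⟨m, hm, hmF⟩ := exists_invariant_mean_orbit (H := F) hM hMZ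
      (fun h f hf => hMG (h : G) f hf) ξ
    refine isAmenableGroup_of_stabilizers hm hmF fun ω => ?_
    obtain ⟨_, g, rfl⟩ := ω
    -- The property of `ξ` passes to its whole orbit by conjugation, so all stabilizers on the orbit
    -- are cyclic.
    have hgξ : ∀ h : F, (∀ᶠ η in 𝓝 (g • ξ), h • η = η) → h = 1 := by
      intro h hh
      have ht : Tendsto (fun η : Boundary E => g • η) (𝓝 ξ) (𝓝 (g • ξ)) :=
        (continuous_const_smul ((g : G) : TreeAut E)).tendsto ξ
      have := hξ (g⁻¹ * h * g) ((ht.eventually hh).mono fun η hη => by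
        rw [mul_smul, mul_smul, hη, inv_smul_smul])
      rwa [mul_assoc, inv_mul_eq_one, eq_comm, mul_eq_right] at this
    have hcomm := commute_stabilizer_of_isotropyGroup F hgξ (hiso (g • ξ))
    have hcyc : IsCyclic (MulAction.stabilizer F (g • ξ)) := IsFreeGroup.isCyclic_of_commute hcomm
    refine (isAmenableGroup_of_isCyclic (G := MulAction.stabilizer F (g • ξ))).of_mulEquiv
      (MulEquiv.subgroupCongr ?_)
    ext h
    rw [MulAction.mem_stabilizer_iff, MulAction.mem_stabilizer_iff, Subtype.ext_iff]
    rfl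
  · push Not at hne
    obtain ⟨i, hi⟩ := hne
    have := finite_treeAut_of_isEmpty hi
    exact isAmenableGroup_of_monotone_finite (fun _ => ⊤) (fun _ _ _ => le_rfl)
      (fun _ => inferInstance) fun g => ⟨0, Subgroup.mem_top g⟩

end RootedTree

theorem mainTheorem4 {E : ℕ → Type*} [∀ i, Finite (E i)]
    (G : Subgroup (RootedTree.TreeAut E))
    (hG : ∀ g ∈ G, RootedTree.TreeAut.IsBounded g) :
    ((∀ w : RootedTree.Boundary E, IsAmenableGroup (IsotropyGroup G w)) →
        IsAmenableGroup G) ∧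
      ((∀ w : RootedTree.Boundary E, ¬ HasNonabelianFreeSubgroup (IsotropyGroup G w)) →
        ¬ HasNonabelianFreeSubgroup G) :=
  ⟨RootedTree.isAmenableGroup_of_isotropyGroup hG,
    RootedTree.not_hasNonabelianFreeSubgroup_of_isotropyGroup hG⟩
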